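/- **Setting.** For $\beta>0$ let $K=K_\beta$ be the Klein bottle $\mathbb C/\langle\sigma,t\rangle$, where $\sigma(z)=\bar z+\pi$ and $t(z)=z+2i\beta$, and let $g_\beta$ be the flat metric induced on it by the Euclidean metric of $\mathbb C$. Riemannian metrics on $K$ are only required to be continuous. For such a metric $g$, let $\mathrm{vol}(g)$ be its area, let $l_v(g)$ be the least length (infimum) of a closed curve in the free homotopy class of $t$, and let $l_\sigma(g)$ be the least length of a closed curve closed by a glide reflection, that is, of a curve in the free homotopy class of $\sigma$ or in that of $t\sigma$ (every $t^k\sigma$, $k\in\mathbb Z$, is conjugate to one of these two). For $b>0$, a metric of the form $f(v)^2du^2+dv^2$, with $f$ continuous, positive, even and $2b$-periodic, is considered on the quotient of the $(u,v)$-plane by $(u,v)\mapsto(u+\pi,-v)$ and $(u,v)\mapsto(u,v+4b)$. It is called *spherical with parameter $b\in(0,\pi/2)$* if $f(v)=\cos v$ for $|v|\le b$, and *flat-spherical with parameters $\omega<b$*, where $\omega\in(0,\pi/2)$, if $f(v)=\cos v$ for $|v|\le\omega$ and $f(v)=\cos\omega$ for $\omega\le|v|\le b$. A metric on $K$ that is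 isometric to one of these is called by the same name. **Theorem.** Let $b_0\in(0,\pi/2)$ be such that $\tan b_0=2b_0$, and let $\beta>0$. 1. If $\beta\le 2\ln\tan\left(\frac\pi4+\frac{b_0}2\right)$, then every Riemannian metric $g$ on $K$ conformal to $g_\beta$ satisfies $$l_v(g)\,l_\sigma(g)\le\frac{\arcsin x}{x}\,\mathrm{vol}(g),\qquad x=\frac{e^\beta-1}{e^\beta+1}.$$ Equality is achieved by a metric conformal to $g_\beta$ that is spherical with parameter $b$, where $b\in(0,b_0]$ and $\beta=2\ln\tan\left(\frac\pi4+\frac b2\right)$. 2. If $\beta>2\ln\tan\left(\frac\pi4+\frac{b_0}2\right)$, then the equation $$2\sin\omega=\left(\beta-2\ln\tan\left(\tfrac\pi4+\tfrac\omega2\right)\right)\cos^2\omega+4\omega\cos\omega$$ has exactly one solution $\omega\in[b_0,\pi/2)$, and every Riemannian metric $g$ on $K$ conformal to $g_\beta$ satisfies $$l_v(g)\,l_\sigma(g)\le\frac1{2\cos\omega}\,\mathrm{vol}(g).$$ Equality is achieved by a metric conformal to $g_\beta$ that is flat-spherical with parameters $\omega<b$, where $b=\tan\omega-\omega$. -/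

import Mathlib

noncomputable section

open Set

namespace Klein

/-! ### The Klein bottle `ℂ / ⟨σ, t⟩` -/

/-- The glide reflection `z ↦ conj z + π`, an isometry of the Euclidean plane. -/
def glide : ℂ ≃ᵢ ℂ :=
  Complex.conjLIE.toIsometryEquiv.trans (IsometryEquiv.addRight (Real.pi : ℂ))

/-- The vertical translation `z ↦ z + 2 i β`. -/
def vert (β : ℝ) : ℂ ≃ᵢ ℂ := IsometryEquiv.addRight (2 * Complex.I * (β : ℂ))

/-- The group of isometries of the plane generated by the glide reflection and the translation. -/
def deckGroup (β : ℝ) : Subgroup (ℂ ≃ᵢ ℂ) := Subgroup.closure {glide, vert β}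

/-- Two points of the plane are identified when a deck transformation maps one to the other. -/
def orbitSetoid (β : ℝ) : Setoid ℂ where
  r z w := ∃ τ ∈ deckGroup β, τ z = w
  iseqv :=
    { refl := fun _ => ⟨1, one_mem _, rfl⟩
      symm := by
        rintro z w ⟨τ, hτ, rfl⟩
        exact ⟨τ⁻¹, inv_mem hτ, τ.symm_apply_apply z⟩
      trans := by
        rintro z w x ⟨τ, hτ, rfl⟩ ⟨ρ, hρ, rfl⟩
        exact ⟨ρ * τ, mul_mem hρ hτ, rfl⟩ }

/-- The Klein bottle, with the quotient topology. -/
abbrev Bottle (β : ℝ) : Type := Quotient (orbitSetoid β)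

/-- The quotient map from the plane onto the Klein bottle. -/
def proj (β : ℝ) (z : ℂ) : Bottle β := Quotient.mk (orbitSetoid β) z

/-! ### Riemannian metrics -/

/-- A (continuous) Riemannian metric on the Klein bottle, written on its universal cover `ℂ`: a
continuous field of inner products on the plane that is invariant under the two generators of the
deck group, whose differentials are complex conjugation and the identity. -/
structure RiemMetric (β : ℝ) where
  form : ℂ → LinearMap.BilinForm ℝ ℂ
  symm : ∀ z ξ η, form z ξ η = form z η ξ
  pos : ∀ z ξ, ξ ≠ 0 → 0 < form z ξ ξ
  cont : ∀ ξ η, Continuous fun z => form z ξ η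
  glide_inv : ∀ z ξ η,
    form (glide z) (starRingEnd ℂ ξ) (starRingEnd ℂ η) = form z ξ η
  vert_inv : ∀ z ξ η, form (vert β z) ξ η = form z ξ η

/-- The flat metric `g_β` induced by the Euclidean metric of the plane. -/
def flat (β : ℝ) : RiemMetric β where
  form _ := innerₗ ℂ
  symm _ ξ η := real_inner_comm η ξ
  pos _ ξ hξ := real_inner_self_pos.2 hξ
  cont _ _ := continuous_const
  glide_inv _ ξ η := by
    simp [Complex.inner]
  vert_inv _ _ _ := rfl

variable {β : ℝ}

/-- Two metrics are conformal if they differ by a positive function. -/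
def RiemMetric.Conformal (g h : RiemMetric β) : Prop :=
  ∃ lam : ℂ → ℝ, (∀ z, 0 < lam z) ∧ ∀ z ξ η, g.form z ξ η = lam z * h.form z ξ η

/-- The length of a curve of the Klein bottle that is lifted to `γ : [0, 1] → ℂ`. -/
def RiemMetric.length (g : RiemMetric β) (γ : ℝ → ℂ) : ℝ :=
  ∫ s in (0 : ℝ)..1, Real.sqrt (g.form (γ s) (deriv γ s) (deriv γ s))

/-- The area of the Klein bottle: the integral of `√(det g)` over the fundamental
domain `[0, π) × [-β, β)`. -/
def RiemMetric.vol (g : RiemMetric β) : ℝ :=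
  ∫ z in Ico 0 Real.pi ×ℂ Ico (-β) β,
    Real.sqrt (g.form z 1 1 * g.form z Complex.I Complex.I - g.form z 1 Complex.I ^ 2)

/-! ### Free homotopy classes and their minimal lengths -/

/-- `γ` is piecewise `C¹` on `[0, 1]`. -/
def PiecewiseC1 (γ : ℝ → ℂ) : Prop :=
  ∃ (n : ℕ) (a : ℕ → ℝ), Monotone a ∧ a 0 = 0 ∧ a n = 1 ∧
    ∀ i < n, ContDiffOn ℝ 1 γ (Icc (a i) (a (i + 1)))

/-- Two loops parametrized by `[0, 1]` are freely homotopic, i.e. homotopic through loops. -/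
def FreelyHomotopic {X : Type*} [TopologicalSpace X] (c₀ c₁ : unitInterval → X) : Prop :=
  ∃ H : C(unitInterval × unitInterval, X),
    (∀ s, H (0, s) = c₀ s) ∧ (∀ s, H (1, s) = c₁ s) ∧ ∀ r, H (r, 0) = H (r, 1)

/-- The least length of a piecewise `C¹` loop of the Klein bottle that is freely homotopic to the
loop `c`; each such loop is given by a lift `γ` to the plane. -/
def RiemMetric.minLength (g : RiemMetric β) (c : unitInterval → Bottle β) : ℝ :=
  sInf {L : ℝ | ∃ γ : ℝ → ℂ, PiecewiseC1 γ ∧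
    FreelyHomotopic (fun s : unitInterval => proj β (γ s)) c ∧ L = g.length γ}

/-- The loop covered by the segment from `0` to `t(0) = 2 i β`. -/
def vertLoop (β : ℝ) (s : unitInterval) : Bottle β :=
  proj β (((s : ℝ) : ℂ) * (2 * Complex.I * (β : ℂ)))

/-- The loop covered by the segment from `0` to `σ(0) = π`. -/
def glideLoop (β : ℝ) (s : unitInterval) : Bottle β :=
  proj β (((s : ℝ) : ℂ) * (Real.pi : ℂ))

/-- The loop covered by the segment from `i β` to `tσ(i β) = i β + π`. -/
def glideLoop' (β : ℝ) (s : unitInterval) : Bottle β :=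
  proj β (Complex.I * (β : ℂ) + ((s : ℝ) : ℂ) * (Real.pi : ℂ))

/-- `l_v`: the least length in the class of the vertical translation. -/
def RiemMetric.lv (g : RiemMetric β) : ℝ := g.minLength (vertLoop β)

/-- `l_σ`: the least length of a curve closed by a glide reflection. The glide reflections
`t ^ k σ` form two conjugacy classes in the deck group, those of `σ` and of `tσ`. -/
def RiemMetric.lσ (g : RiemMetric β) : ℝ :=
  min (g.minLength (glideLoop β)) (g.minLength (glideLoop' β))

/-! ### Spherical and flat-spherical metrics -/

/-- An isometry between two Klein bottles, as a `C¹` diffeomorphism of their universal covers that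
descends to a bijection of the quotients and pulls one metric back to the other. -/
def RiemMetric.Isometric {β' : ℝ} (g : RiemMetric β) (h : RiemMetric β') : Prop :=
  ∃ Φ : ℂ ≃ₜ ℂ, ContDiff ℝ 1 Φ ∧ ContDiff ℝ 1 Φ.symm ∧
    (∀ z w, proj β z = proj β w ↔ proj β' (Φ z) = proj β' (Φ w)) ∧
    ∀ z ξ η, g.form z ξ η = h.form (Φ z) (fderiv ℝ Φ z ξ) (fderiv ℝ Φ z η)

/-- The metric is `f(v)² du² + dv²` in the coordinates `z = u + i v`. -/
def RiemMetric.IsWarped (g : RiemMetric β) (f : ℝ → ℝ) : Prop :=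
  ∀ z ξ η, g.form z ξ η = f z.im ^ 2 * (ξ.re * η.re) + ξ.im * η.im

/-- The spherical metric `f(v)² du² + dv²` on the quotient of the `(u, v)`-plane
by `(u, v) ↦ (u + π, -v)` and `(u, v) ↦ (u, v + 4 b)`, where `f` is `2 b`-periodic and equal to
`cos` on `[-b, b]`. -/
def IsSphericalModel (b : ℝ) (h : RiemMetric (2 * b)) : Prop :=
  ∃ f : ℝ → ℝ, Function.Periodic f (2 * b) ∧ (∀ v, |v| ≤ b → f v = Real.cos v) ∧ h.IsWarped f

/-- The flat-spherical metric `f(v)² du² + dv²` on the same quotient, where `f` is `2 b`-periodic,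
equal to `cos` on `[-ω, ω]` and equal to the constant `cos ω` for `ω ≤ |v| ≤ b`. -/
def IsFlatSphericalModel (b ω : ℝ) (h : RiemMetric (2 * b)) : Prop :=
  ∃ f : ℝ → ℝ, Function.Periodic f (2 * b) ∧ (∀ v, |v| ≤ ω → f v = Real.cos v) ∧
    (∀ v, ω ≤ |v| → |v| ≤ b → f v = Real.cos ω) ∧ h.IsWarped f

/-- `g` is isometric to the spherical model with parameter `b`. -/
def RiemMetric.IsSpherical (g : RiemMetric β) (b : ℝ) : Prop :=
  ∃ h : RiemMetric (2 * b), IsSphericalModel b h ∧ g.Isometric h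

/-- `g` is isometric to the flat-spherical model with parameters `b` and `ω`. -/
def RiemMetric.IsFlatSpherical (g : RiemMetric β) (b ω : ℝ) : Prop :=
  ∃ h : RiemMetric (2 * b), IsFlatSphericalModel b ω h ∧ g.Isometric h

end Klein

end

noncomputable section

open Set

namespace Klein

/-! ### The deck group and the covering -/

/-! The upper bound is a calibration argument inside one conformal class. A metric conformal to the
flat one has the form φ²|dz|². Its lengths are averaged over two families of curves: the vertical
lines, with weight m, and the arcs y = arsinh(T sin θ), 0 ≤ θ ≤ π, which are great circle arcs of
the sphere in the Mercator projection. Such an arc is closed by σ and, once raised by β, by tσ.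
Averaging over horizontal translations leaves a function of y alone, `RiemMetric.avg`. The
distribution of the slopes T < τ solves an Abel-type equation. If (T, θ) are polar coordinates of a
plane and Z = T sin θ = sinh y, it is a radial density whose integral along each line Z = const is 1
/ cosh y - m (`lintegral_arcWeight_line`). Vertical lines and arcs together then have density w = 1
/ cosh y for |y| ≤ L = arsinh τ. Hence A + B is at most the integral of `avg` against w, where A is
a multiple of l_v and B a multiple of l_σ (`RiemMetric.Conformal.le_integral_avg_mul`).
Cauchy–Schwarz and 4AB ≤ (A + B)² give the inequality (`RiemMetric.Conformal.lv_mul_lσ_le`). Both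
are sharp when φ = w and A = B. The candidate w is `profile`: 1 / cosh y near the lines y ∈ βℤ,
truncated below at 1 / cosh L = cos ω, where tan ω = sinh L. For the metric w²|dz|² only lower
bounds on l_v and l_σ are needed, the opposite inequality being the one just proved. The arc length
in the vertical direction bounds l_v. The bound l_σ ≥ π holds because w dominates the factor of a
round sphere centred on each line y = kβ, and a curve closed by t^{2k'}σ or by an odd analogue joins
antipodal points of one of these spheres. The density of arcs is nonnegative, and w ≥ m, provided m
≤ cos ω. Without a plateau (ω = b, L = β / 2) the balance A = B requires m = sin b / (2b), which is
admissible exactly when tan b ≤ 2b, that is b ≤ b₀. Beyond this threshold m = cos ω, and the balance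
fixes the length of the plateau: b = tan ω - ω, which is the equation for ω. -/

theorem glide_re (z : ℂ) : (glide z).re = z.re + Real.pi := by simp [glide]
theorem glide_im (z : ℂ) : (glide z).im = -z.im := by simp [glide]
theorem vert_re (β : ℝ) (z : ℂ) : (vert β z).re = z.re := by simp [vert]
theorem vert_im (β : ℝ) (z : ℂ) : (vert β z).im = z.im + 2 * β := by simp [vert]

theorem neg_one_zpow_mul_self (n : ℤ) : (-1 : ℝ) ^ n * (-1 : ℝ) ^ n = 1 := by
  rcases Int.even_or_odd n with h | h
  · simp [h.neg_one_zpow]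
  · simp [h.neg_one_zpow]

/-- The action of `t ^ k σ ^ n`, in coordinates. -/
def ActsAs (β : ℝ) (n k : ℤ) (z w : ℂ) : Prop :=
  w.re = z.re + n * Real.pi ∧ w.im = (-1 : ℝ) ^ n * z.im + 2 * β * k

theorem glide_zpow_apply (n : ℤ) (z : ℂ) :
    ((glide ^ n) z).re = z.re + n * Real.pi ∧ ((glide ^ n) z).im = (-1 : ℝ) ^ n * z.im := by
  have hstep : ∀ w : ℂ, (glide⁻¹ w).re = w.re - Real.pi ∧ (glide⁻¹ w).im = -w.im := by
    intro w
    have h : glide (glide⁻¹ w) = w := glide.apply_symm_apply w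
    have h1 := glide_re (glide⁻¹ w)
    have h2 := glide_im (glide⁻¹ w)
    rw [h] at h1 h2
    constructor <;> linarith
  induction n using Int.induction_on generalizing z with
  | zero => simp
  | succ i ih =>
    rw [zpow_add_one, IsometryEquiv.mul_apply, (ih _).1, (ih _).2, glide_re, glide_im,
      zpow_add_one₀ (by norm_num)]
    push_cast
    constructor <;> ring
  | pred i ih =>
    rw [zpow_sub_one, IsometryEquiv.mul_apply, (ih _).1, (ih _).2, (hstep z).1, (hstep z).2,
      zpow_sub_one₀ (by norm_num)]
    push_cast
    constructor <;> ring

theorem vert_zpow_apply (β : ℝ) (k : ℤ) (z : ℂ) :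
    ((vert β ^ k) z).re = z.re ∧ ((vert β ^ k) z).im = z.im + 2 * β * k := by
  have hstep : ∀ w : ℂ, ((vert β)⁻¹ w).re = w.re ∧ ((vert β)⁻¹ w).im = w.im - 2 * β := by
    intro w
    have h : vert β ((vert β)⁻¹ w) = w := (vert β).apply_symm_apply w
    have h1 := vert_re β ((vert β)⁻¹ w)
    have h2 := vert_im β ((vert β)⁻¹ w)
    rw [h] at h1 h2
    constructor <;> linarith
  induction k using Int.induction_on generalizing z with
  | zero => simp
  | succ i ih =>
    rw [zpow_add_one, IsometryEquiv.mul_apply, (ih _).1, (ih _).2, vert_re, vert_im]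
    push_cast
    constructor <;> ring
  | pred i ih =>
    rw [zpow_sub_one, IsometryEquiv.mul_apply, (ih _).1, (ih _).2, (hstep z).1, (hstep z).2]
    push_cast
    constructor <;> ring

theorem exists_mem_deckGroup (β : ℝ) (n k : ℤ) :
    ∃ τ ∈ deckGroup β, ∀ z, ActsAs β n k z (τ z) := by
  refine ⟨vert β ^ k * glide ^ n, mul_mem (zpow_mem (Subgroup.subset_closure (by simp)) _)
    (zpow_mem (Subgroup.subset_closure (by simp)) _), fun z => ?_⟩
  rw [ActsAs, IsometryEquiv.mul_apply, (vert_zpow_apply β k _).1, (vert_zpow_apply β k _).2,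
    (glide_zpow_apply n z).1, (glide_zpow_apply n z).2]
  exact ⟨rfl, rfl⟩

theorem exists_actsAs_of_mem_deckGroup {β : ℝ} {τ : ℂ ≃ᵢ ℂ} (hτ : τ ∈ deckGroup β) :
    ∃ n k : ℤ, ∀ z, ActsAs β n k z (τ z) := by
  induction hτ using Subgroup.closure_induction with
  | mem x hx =>
    rcases hx with rfl | rfl
    · refine ⟨1, 0, fun z => ?_⟩
      simp [ActsAs, glide_re, glide_im]
    · refine ⟨0, 1, fun z => ?_⟩
      simp [ActsAs, vert_re, vert_im]
  | one => exact ⟨0, 0, fun z => by simp [ActsAs]⟩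
  | mul x y _ _ hx hy =>
    obtain ⟨n, k, h⟩ := hx
    obtain ⟨n', k', h'⟩ := hy
    -- Moving t past σ ^ n turns it into its inverse when n is odd, so this sign multiplies the
    -- vertical exponent and has to be available as an integer.
    have h2 : ∃ j : ℤ, (j : ℝ) = (-1 : ℝ) ^ n := ⟨((-1 : ℤˣ) ^ n : ℤˣ), by
      rcases Int.even_or_odd n with h | h <;> simp [h.neg_one_zpow]⟩
    obtain ⟨j, hj⟩ := h2
    refine ⟨n + n', j * k' + k, fun z => ?_⟩
    rw [ActsAs, IsometryEquiv.mul_apply, (h _).1, (h _).2, (h' _).1, (h' _).2,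
      zpow_add₀ (by norm_num)]
    push_cast
    rw [hj]
    constructor <;> ring
  | inv x _ hx =>
    obtain ⟨n, k, h⟩ := hx
    have h2 : ∃ j : ℤ, (j : ℝ) = (-1 : ℝ) ^ n := ⟨((-1 : ℤˣ) ^ n : ℤˣ), by
      rcases Int.even_or_odd n with h | h <;> simp [h.neg_one_zpow]⟩
    obtain ⟨j, hj⟩ := h2
    refine ⟨-n, -(j * k), fun z => ?_⟩
    have hz : x (x⁻¹ z) = z := x.apply_symm_apply z
    have h1 := h (x⁻¹ z)
    rw [hz] at h1
    obtain ⟨h1, h3⟩ := h1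
    rw [ActsAs]
    push_cast
    rw [hj, zpow_neg, inv_eq_of_mul_eq_one_left (neg_one_zpow_mul_self n), h1, h3]
    constructor
    · ring
    · have := neg_one_zpow_mul_self n
      linear_combination -(x⁻¹ z).im * this

/-- Every deck transformation has the normal form t ^ k σ ^ n, so the orbits can be described in
coordinates. -/
theorem proj_eq_iff {β : ℝ} {z w : ℂ} : proj β z = proj β w ↔ ∃ n k : ℤ, ActsAs β n k z w := by
  rw [proj, proj, Quotient.eq]
  constructor
  · rintro ⟨τ, hτ, rfl⟩
    obtain ⟨n, k, h⟩ := exists_actsAs_of_mem_deckGroup hτ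
    exact ⟨n, k, h z⟩
  · rintro ⟨n, k, h⟩
    obtain ⟨τ, hτ, h'⟩ := exists_mem_deckGroup β n k
    exact ⟨τ, hτ, Complex.ext ((h' z).1.trans h.1.symm) ((h' z).2.trans h.2.symm)⟩

theorem continuous_proj (β : ℝ) : Continuous (proj β) := continuous_quotient_mk'

theorem isCoveringMap_proj {β : ℝ} (hβ : 0 < β) : IsCoveringMap (proj β) := by
  let _ : MulAction (deckGroup β) ℂ :=
    { smul := fun τ z => τ.1 z
      one_smul := fun _ => rfl
      mul_smul := fun _ _ _ => rfl }
  have h : IsQuotientCoveringMap (proj β) (deckGroup β) :=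
    { isQuotientMap_quotient_mk' with
      continuous_const_smul := fun τ => τ.1.continuous
      apply_eq_iff_mem_orbit := by
        intro z w
        rw [eq_comm, proj, proj, Quotient.eq]
        exact ⟨fun ⟨τ, hτ, h⟩ => ⟨⟨τ, hτ⟩, h⟩, fun ⟨τ, h⟩ => ⟨τ.1, τ.2, h⟩⟩
      disjoint := by
        intro e
        have hε : 0 < min (Real.pi / 2) β := lt_min (by positivity) hβ
        -- Two points of this ball are less than π apart horizontally and less than 2β apart
        -- vertically. A deck transformation moving one to the other therefore has n = 0, and then k
        -- = 0.
        refine ⟨Metric.ball e (min (Real.pi / 2) β), Metric.ball_mem_nhds _ hε, ?_⟩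
        rintro ⟨τ, hτ⟩ ⟨w, ⟨z, hz, hzw⟩, hw⟩
        obtain ⟨n, k, h⟩ := exists_actsAs_of_mem_deckGroup hτ
        replace hzw : τ z = w := hzw
        have hd : ‖w - z‖ < 2 * min (Real.pi / 2) β := by
          rw [← dist_eq_norm]
          linarith [dist_triangle_right w z e, Metric.mem_ball.1 hw, Metric.mem_ball.1 hz]
        have hre := (Complex.abs_re_le_norm _).trans_lt hd
        have him := (Complex.abs_im_le_norm _).trans_lt hd
        rw [← hzw, Complex.sub_re, (h z).1] at hre
        rw [← hzw, Complex.sub_im, (h z).2] at him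
        have hn : n = 0 := by
          have h3 : |(n : ℝ)| * Real.pi < 1 * Real.pi := by
            calc |(n : ℝ)| * Real.pi = |(n : ℝ) * Real.pi| := by
                  rw [abs_mul, abs_of_pos Real.pi_pos]
              _ = |z.re + n * Real.pi - z.re| := by ring_nf
              _ < _ := hre
              _ ≤ 1 * Real.pi := by linarith [min_le_left (Real.pi / 2) β]
          have h4 := lt_of_mul_lt_mul_right h3 Real.pi_pos.le
          exact Int.abs_lt_one_iff.1 (by exact_mod_cast h4)
        subst hn
        have hk : k = 0 := by
          have h3 : |(k : ℝ)| * (2 * β) < 1 * (2 * β) := by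
            have hp : 0 < 2 * β := by positivity
            calc |(k : ℝ)| * (2 * β) = |(k : ℝ) * (2 * β)| := by rw [abs_mul, abs_of_pos hp]
              _ = |(-1 : ℝ) ^ (0 : ℤ) * z.im + 2 * β * k - z.im| := by
                  rw [zpow_zero]; ring_nf
              _ < _ := him
              _ ≤ 1 * (2 * β) := by linarith [min_le_right (Real.pi / 2) β]
          have h4 := lt_of_mul_lt_mul_right h3 (by positivity)
          exact Int.abs_lt_one_iff.1 (by exact_mod_cast h4)
        subst hk
        refine Subtype.ext (IsometryEquiv.ext fun z => ?_)
        have := h z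
        simp only [ActsAs, Int.cast_zero, zpow_zero] at this
        exact Complex.ext (by simpa using this.1) (by simpa using this.2) }
  exact h.isCoveringMap

/-! ### Free homotopy classes determine the deck transformation joining the ends of a lift -/

/-- A continuous map from a connected space to a discrete one is constant; rounding f / p exhibits
such a map. -/
theorem eq_of_continuous_of_mem_zmultiples {f : unitInterval → ℝ} (hf : Continuous f) {p : ℝ}
    (hp : 0 < p) (h : ∀ r, ∃ n : ℤ, f r = n * p) (r r' : unitInterval) : f r = f r' := by
  have hr : ∀ r, f r / p = round (f r / p) := by
    intro r
    obtain ⟨n, hn⟩ := h r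
    rw [hn, mul_div_cancel_right₀ _ hp.ne', round_intCast]
  have hc : Continuous fun r => (round (f r / p) : ℤ) := by
    rw [Int.isClosedEmbedding_coe_real.isInducing.continuous_iff]
    exact (hf.div_const p).congr hr
  have := IsPreconnected.constant isPreconnected_univ hc.continuousOn (mem_univ r) (mem_univ r')
  have h2 : f r / p = f r' / p := by rw [hr r, hr r', this]
  field_simp at h2
  exact h2

/-- A free homotopy in the Klein bottle lifts to a homotopy in the plane. -/
theorem FreelyHomotopic.exists_lift {β : ℝ} (hβ : 0 < β) {γ δ : ℝ → ℂ}
    (hγ : ContinuousOn γ (Icc 0 1)) (hδ : Continuous δ)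
    (h : FreelyHomotopic (fun s : unitInterval => proj β (γ s))
      (fun s : unitInterval => proj β (δ s))) :
    ∃ F : C(unitInterval × unitInterval, ℂ), (∀ s : unitInterval, F (0, s) = γ s) ∧
      (∀ r, ∃ n k : ℤ, ActsAs β n k (F (r, 0)) (F (r, 1))) ∧
      ∃ n k : ℤ, ∀ s : unitInterval, ActsAs β n k (δ s) (F (1, s)) := by
  obtain ⟨H, h0, h1, hr⟩ := h
  have cov := isCoveringMap_proj hβ
  let f : C(unitInterval, ℂ) := ⟨fun s => γ s, continuousOn_iff_continuous_domRestrict.1 hγ⟩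
  let F := cov.liftHomotopy H f h0
  have hF : ∀ p, proj β (F p) = H p := fun p => congrFun (cov.liftHomotopy_lifts H f h0) p
  have hF1 : ∃ n k : ℤ, ActsAs β n k (δ 0) (F (1, 0)) := by
    rw [← proj_eq_iff, hF, h1]
    rfl
  obtain ⟨n, k, hnk⟩ := hF1
  obtain ⟨τ, hτ, hact⟩ := exists_mem_deckGroup β n k
  refine ⟨F, cov.liftHomotopy_zero H f h0, fun r => ?_, n, k, fun s => ?_⟩
  · rw [← proj_eq_iff, hF, hF, hr]
  -- Uniqueness of lifts: the final stage of the lifted homotopy and the deck translate of δ lift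
  -- the same loop and agree at 0.
  · have heq : (fun s : unitInterval => F (1, s)) = fun s : unitInterval => τ (δ s) := by
      refine cov.eq_of_comp_eq (by fun_prop)
        (τ.continuous.comp (hδ.comp continuous_subtype_val)) ?_ 0 ?_
      · funext s
        simp only [Function.comp_apply]
        rw [hF, h1, proj_eq_iff]
        exact ⟨n, k, hact _⟩
      · exact Complex.ext (hnk.1.trans (hact _).1.symm) (hnk.2.trans (hact _).2.symm)
    rw [show F (1, s) = τ (δ s) from congrFun heq s]
    exact hact _

/-- At each stage of the lifted homotopy the horizontal displacement is a multiple of π, and it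
varies continuously. -/
theorem FreelyHomotopic.re_sub_eq {β : ℝ} (hβ : 0 < β) {γ δ : ℝ → ℂ}
    (hγ : ContinuousOn γ (Icc 0 1)) (hδ : Continuous δ)
    (h : FreelyHomotopic (fun s : unitInterval => proj β (γ s))
      (fun s : unitInterval => proj β (δ s))) :
    (γ 1 - γ 0).re = (δ 1 - δ 0).re := by
  obtain ⟨F, h0, hr, n, k, h1⟩ := h.exists_lift hβ hγ hδ
  have := eq_of_continuous_of_mem_zmultiples (f := fun r => (F (r, 1) - F (r, 0)).re)
    (by fun_prop) Real.pi_pos (fun r => by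
      obtain ⟨n, k, h⟩ := hr r
      exact ⟨n, by rw [Complex.sub_re, h.1]; ring⟩) 0 1
  simp only [h0, Complex.sub_re, (h1 _).1] at this
  simp only [Set.Icc.coe_zero, Set.Icc.coe_one] at this
  rw [Complex.sub_re, Complex.sub_re, this]
  ring

/-- Zero horizontal displacement persists along the homotopy and forces n = 0, so the vertical
displacement stays in 2βℤ and is constant. The sign is lost because the final stage is only a deck
translate of δ, and σ reverses the vertical direction. -/
theorem FreelyHomotopic.abs_im_sub_eq {β : ℝ} (hβ : 0 < β) {γ δ : ℝ → ℂ}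
    (hγ : ContinuousOn γ (Icc 0 1)) (hδ : Continuous δ)
    (h : FreelyHomotopic (fun s : unitInterval => proj β (γ s))
      (fun s : unitInterval => proj β (δ s))) (hre : (δ 1 - δ 0).re = 0) :
    |(γ 1 - γ 0).im| = |(δ 1 - δ 0).im| := by
  obtain ⟨F, h0, hr, n, k, h1⟩ := h.exists_lift hβ hγ hδ
  have hconst : ∀ r, (F (r, 1) - F (r, 0)).re = 0 := by
    intro r
    rw [eq_of_continuous_of_mem_zmultiples (f := fun r => (F (r, 1) - F (r, 0)).re)
      (by fun_prop) Real.pi_pos (fun r => by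
        obtain ⟨n, k, h⟩ := hr r
        exact ⟨n, by rw [Complex.sub_re, h.1]; ring⟩) r 1, ← hre]
    simp only [Complex.sub_re, (h1 _).1, Set.Icc.coe_zero, Set.Icc.coe_one]
    ring
  have := eq_of_continuous_of_mem_zmultiples (f := fun r => (F (r, 1) - F (r, 0)).im)
    (by fun_prop) (mul_pos two_pos hβ) (fun r => by
      obtain ⟨n, k, h⟩ := hr r
      have h2 := hconst r
      rw [Complex.sub_re, h.1, add_sub_cancel_left, mul_eq_zero] at h2
      have hn : n = 0 := by exact_mod_cast h2.resolve_right Real.pi_ne_zero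
      subst hn
      exact ⟨k, by rw [Complex.sub_im, h.2, zpow_zero]; ring⟩) 0 1
  simp only [h0, Complex.sub_im, (h1 _).2] at this
  simp only [Set.Icc.coe_zero, Set.Icc.coe_one] at this
  rw [Complex.sub_im, Complex.sub_im, this, add_sub_add_right_eq_sub, ← mul_sub, abs_mul]
  simp [abs_zpow]

theorem FreelyHomotopic.exists_actsAs {β : ℝ} {γ δ : ℝ → ℂ}
    (h : FreelyHomotopic (fun s : unitInterval => proj β (γ s))
      (fun s : unitInterval => proj β (δ s))) :
    ∃ n k : ℤ, ActsAs β n k (γ 0) (γ 1) := by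
  obtain ⟨H, h0, h1, hr⟩ := h
  have := hr 0
  rw [h0, h0, proj_eq_iff] at this
  simpa using this

/-- A loop in the class of the vertical translation ends at the image of its origin under that
translation or its inverse. -/
theorem FreelyHomotopic.of_vertLoop {β : ℝ} (hβ : 0 < β) {γ : ℝ → ℂ}
    (hγ : ContinuousOn γ (Icc 0 1))
    (h : FreelyHomotopic (fun s : unitInterval => proj β (γ s)) (vertLoop β)) :
    |(γ 1).im - (γ 0).im| = 2 * β := by
  have := FreelyHomotopic.abs_im_sub_eq (δ := fun s => (s : ℂ) * (2 * Complex.I * (β : ℂ)))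
    hβ hγ (by fun_prop) h (by simp)
  rw [Complex.sub_im] at this
  rw [this]
  simp [abs_of_pos hβ]

theorem ActsAs.of_re_sub_eq_pi {β : ℝ} {n k : ℤ} {z w : ℂ} (h : ActsAs β n k z w)
    (hre : (w - z).re = Real.pi) : ActsAs β 1 k z w := by
  rw [Complex.sub_re, h.1, add_sub_cancel_left] at hre
  have hn : n = 1 := by exact_mod_cast mul_right_cancel₀ Real.pi_ne_zero (hre.trans (one_mul _).symm)
  exact hn ▸ h

/-- The horizontal displacement π determines n = 1. The exponent k may be left undetermined, since
the lower bound on lengths is uniform in k. -/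
theorem FreelyHomotopic.of_glideLoop {β : ℝ} (hβ : 0 < β) {γ : ℝ → ℂ}
    (hγ : ContinuousOn γ (Icc 0 1))
    (h : FreelyHomotopic (fun s : unitInterval => proj β (γ s)) (glideLoop β)) :
    ∃ k : ℤ, ActsAs β 1 k (γ 0) (γ 1) := by
  obtain ⟨n, k, hnk⟩ := FreelyHomotopic.exists_actsAs (δ := fun s => (s : ℂ) * (Real.pi : ℂ)) h
  exact ⟨k, hnk.of_re_sub_eq_pi ((FreelyHomotopic.re_sub_eq
    (δ := fun s => (s : ℂ) * (Real.pi : ℂ)) hβ hγ (by fun_prop) h).trans (by simp))⟩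

theorem FreelyHomotopic.of_glideLoop' {β : ℝ} (hβ : 0 < β) {γ : ℝ → ℂ}
    (hγ : ContinuousOn γ (Icc 0 1))
    (h : FreelyHomotopic (fun s : unitInterval => proj β (γ s)) (glideLoop' β)) :
    ∃ k : ℤ, ActsAs β 1 k (γ 0) (γ 1) := by
  obtain ⟨n, k, hnk⟩ := FreelyHomotopic.exists_actsAs
    (δ := fun s => Complex.I * (β : ℂ) + (s : ℂ) * (Real.pi : ℂ)) h
  exact ⟨k, hnk.of_re_sub_eq_pi ((FreelyHomotopic.re_sub_eq
    (δ := fun s => Complex.I * (β : ℂ) + (s : ℂ) * (Real.pi : ℂ)) hβ hγ (by fun_prop) h).trans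
      (by simp))⟩

/-! ### Lengths of piecewise `C¹` curves -/

theorem piecewiseC1_of_contDiff {γ : ℝ → ℂ} (h : ContDiff ℝ 1 γ) : PiecewiseC1 γ :=
  ⟨1, fun i => i, Nat.mono_cast, by simp, by simp, fun _ _ => h.contDiffOn⟩

theorem PiecewiseC1.continuousOn {γ : ℝ → ℂ} (hγ : PiecewiseC1 γ) :
    ContinuousOn γ (Icc 0 1) := by
  obtain ⟨n, a, hmono, h0, h1, h⟩ := hγ
  have : ∀ j ≤ n, ContinuousOn γ (Icc 0 (a j)) := by
    intro j
    induction j with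
    | zero => intro _; rw [h0, Icc_self]; exact continuousOn_singleton _ _
    | succ j ih =>
      intro hj
      have hj' : j < n := by omega
      rw [← Icc_union_Icc_eq_Icc (h0 ▸ hmono (Nat.zero_le j)) (hmono (Nat.le_succ j))]
      exact (ih hj'.le).union_of_isClosed (h j hj').continuousOn isClosed_Icc isClosed_Icc
  exact h1 ▸ this n le_rfl

/-- The two-sided derivative is controlled only in the open interval, where it agrees with the
continuous `derivWithin`; the endpoints are negligible. -/
theorem ContDiffOn.intervalIntegrable_mul_norm_deriv {γ : ℝ → ℂ} {a b : ℝ} (hab : a ≤ b)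
    (hγ : ContDiffOn ℝ 1 γ (Icc a b)) {φ : ℂ → ℝ} (hφ : Continuous φ) :
    IntervalIntegrable (fun s => φ (γ s) * ‖deriv γ s‖) MeasureTheory.volume a b := by
  rcases hab.eq_or_lt with rfl | hab
  · exact IntervalIntegrable.refl
  have hc : ContinuousOn (fun s => φ (γ s) * ‖derivWithin γ (Icc a b) s‖) (Icc a b) :=
    (hφ.comp_continuousOn hγ.continuousOn).mul
      (hγ.continuousOn_derivWithin (uniqueDiffOn_Icc hab) le_rfl).norm
  have hi := (hc.integrableOn_Icc (μ := MeasureTheory.volume)).mono_set Ioo_subset_Icc_self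
  rw [intervalIntegrable_iff_integrableOn_Ioo_of_le hab.le]
  refine hi.congr_fun (fun s hs => ?_) measurableSet_Ioo
  simp only [derivWithin_of_mem_nhds (Icc_mem_nhds hs.1 hs.2)]

theorem ContDiffOn.sub_le_integral_mul_norm_deriv {γ : ℝ → ℂ} {a b : ℝ} (hab : a ≤ b)
    (hγ : ContDiffOn ℝ 1 γ (Icc a b)) {φ : ℂ → ℝ} (hφ : Continuous φ) {G : ℂ → ℝ}
    (hG : Differentiable ℝ G) (hle : ∀ z ξ, fderiv ℝ G z ξ ≤ φ z * ‖ξ‖) :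
    G (γ b) - G (γ a) ≤ ∫ s in a..b, φ (γ s) * ‖deriv γ s‖ := by
  refine intervalIntegral.sub_le_integral_of_hasDeriv_right_of_le hab
    (hG.continuous.comp_continuousOn hγ.continuousOn) (g := G ∘ γ)
    (g' := fun s => fderiv ℝ G (γ s) (deriv γ s)) (fun s hs => ?_) ?_ (fun s _ => hle _ _)
  · have hd : DifferentiableAt ℝ γ s :=
      (hγ.differentiableOn one_ne_zero).differentiableAt (Icc_mem_nhds hs.1 hs.2)
    exact ((hG (γ s)).hasFDerivAt.comp_hasDerivAt s hd.hasDerivAt).hasDerivWithinAt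
  · rw [← intervalIntegrable_iff_integrableOn_Icc_of_le hab]
    exact ContDiffOn.intervalIntegrable_mul_norm_deriv hab hγ hφ

/-- A function whose gradient is bounded by `φ` bounds from below the lengths of curves for the
metric with conformal factor `φ ^ 2`. -/
theorem PiecewiseC1.sub_le_integral {γ : ℝ → ℂ} (hγ : PiecewiseC1 γ) {φ : ℂ → ℝ}
    (hφ : Continuous φ) {G : ℂ → ℝ} (hG : Differentiable ℝ G)
    (hle : ∀ z ξ, fderiv ℝ G z ξ ≤ φ z * ‖ξ‖) :
    G (γ 1) - G (γ 0) ≤ ∫ s in (0 : ℝ)..1, φ (γ s) * ‖deriv γ s‖ := by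
  obtain ⟨n, a, hmono, h0, h1, h⟩ := hγ
  have : ∀ j ≤ n,
      IntervalIntegrable (fun s => φ (γ s) * ‖deriv γ s‖) MeasureTheory.volume 0 (a j) ∧
      G (γ (a j)) - G (γ 0) ≤ ∫ s in (0 : ℝ)..(a j), φ (γ s) * ‖deriv γ s‖ := by
    intro j
    induction j with
    | zero => intro _; rw [h0]; simp
    | succ j ih =>
      intro hj
      have hj' : j < n := by omega
      have hi := ContDiffOn.intervalIntegrable_mul_norm_deriv (hmono (Nat.le_succ j)) (h j hj') hφ
      have hs := ContDiffOn.sub_le_integral_mul_norm_deriv (hmono (Nat.le_succ j)) (h j hj') hφ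
        hG hle
      refine ⟨(ih hj'.le).1.trans hi, ?_⟩
      rw [← intervalIntegral.integral_add_adjacent_intervals (ih hj'.le).1 hi]
      linarith [(ih hj'.le).2]
  have h2 := (this n le_rfl).2
  rwa [h1] at h2

/-! ### Conformal metrics -/

/-- The conformal factor of a metric conformal to the flat one: the length of the unit vectors. -/
def RiemMetric.factor {β : ℝ} (g : RiemMetric β) (z : ℂ) : ℝ := Real.sqrt (g.form z 1 1)

section factor
variable {β : ℝ} (g : RiemMetric β)

theorem RiemMetric.factor_pos (z : ℂ) : 0 < g.factor z :=
  Real.sqrt_pos.2 (g.pos z 1 one_ne_zero)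

theorem RiemMetric.continuous_factor : Continuous g.factor := (g.cont 1 1).sqrt

theorem RiemMetric.factor_glide (z : ℂ) : g.factor (glide z) = g.factor z := by
  have := g.glide_inv z 1 1
  rw [map_one] at this
  rw [factor, factor, this]

theorem RiemMetric.factor_vert (z : ℂ) : g.factor (vert β z) = g.factor z := by
  rw [factor, factor, g.vert_inv]

variable {g}

theorem RiemMetric.Conformal.form_eq (hg : g.Conformal (flat β)) (z ξ η : ℂ) :
    g.form z ξ η = g.factor z ^ 2 * inner ℝ ξ η := by
  obtain ⟨lam, hpos, h⟩ := hg
  have h1 : ∀ z ξ η, g.form z ξ η = lam z * inner ℝ ξ η := h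
  rw [factor, Real.sq_sqrt (g.pos z 1 one_ne_zero).le, h1, h1]
  simp

theorem RiemMetric.Conformal.length_eq (hg : g.Conformal (flat β)) (γ : ℝ → ℂ) :
    g.length γ = ∫ s in (0 : ℝ)..1, g.factor (γ s) * ‖deriv γ s‖ := by
  simp only [length, hg.form_eq, real_inner_self_eq_norm_sq, ← mul_pow]
  refine intervalIntegral.integral_congr fun s _ => ?_
  exact Real.sqrt_sq (mul_nonneg (g.factor_pos _).le (norm_nonneg _))

theorem RiemMetric.Conformal.vol_eq (hg : g.Conformal (flat β)) :
    g.vol = ∫ z in Ico 0 Real.pi ×ℂ Ico (-β) β, g.factor z ^ 2 := by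
  simp only [vol, hg.form_eq]
  congr 1
  funext z
  refine Eq.trans (congrArg Real.sqrt ?_) (Real.sqrt_sq (sq_nonneg (g.factor z)))
  simp [Complex.inner]
  ring

theorem RiemMetric.length_nonneg (g : RiemMetric β) (γ : ℝ → ℂ) : 0 ≤ g.length γ :=
  intervalIntegral.integral_nonneg zero_le_one fun _ _ => Real.sqrt_nonneg _

theorem RiemMetric.minLength_le (g : RiemMetric β) {c : unitInterval → Bottle β} {γ : ℝ → ℂ}
    (hγ : PiecewiseC1 γ) (h : FreelyHomotopic (fun s : unitInterval => proj β (γ s)) c) :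
    g.minLength c ≤ g.length γ :=
  csInf_le ⟨0, by rintro _ ⟨γ, -, -, rfl⟩; exact g.length_nonneg γ⟩ ⟨γ, hγ, h, rfl⟩

theorem RiemMetric.minLength_nonneg (g : RiemMetric β) (c : unitInterval → Bottle β) :
    0 ≤ g.minLength c :=
  Real.sInf_nonneg (by rintro _ ⟨γ, -, -, rfl⟩; exact g.length_nonneg γ)

theorem RiemMetric.le_minLength (g : RiemMetric β) {δ : ℝ → ℂ} (hδ : ContDiff ℝ 1 δ)
    (hloop : proj β (δ 0) = proj β (δ 1)) {B : ℝ}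
    (h : ∀ γ : ℝ → ℂ, PiecewiseC1 γ → FreelyHomotopic (fun s : unitInterval => proj β (γ s))
      (fun s : unitInterval => proj β (δ s)) → B ≤ g.length γ) :
    B ≤ g.minLength (fun s : unitInterval => proj β (δ s)) := by
  -- The loop δ itself belongs to its class. This matters: the infimum of an empty set of reals
  -- would be 0.
  refine le_csInf ⟨_, δ, piecewiseC1_of_contDiff hδ, ?_, rfl⟩
    (by rintro _ ⟨γ, h1, h2, rfl⟩; exact h γ h1 h2)
  refine ⟨⟨fun p => proj β (δ p.2), (continuous_proj β).comp
    (hδ.continuous.comp (continuous_subtype_val.comp continuous_snd))⟩, fun _ => rfl,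
    fun _ => rfl, fun _ => ?_⟩
  simpa using hloop

end factor

/-- Two lifted loops that are joined by a homotopy of the plane whose ends correspond. -/
theorem freelyHomotopic_of_segment {β : ℝ} {γ δ : ℝ → ℂ} (hγ : Continuous γ) (hδ : Continuous δ)
    (h : ∀ r ∈ Icc (0 : ℝ) 1, proj β ((1 - r) * γ 0 + r * δ 0) = proj β ((1 - r) * γ 1 + r * δ 1)) :
    FreelyHomotopic (fun s : unitInterval => proj β (γ s))
      (fun s : unitInterval => proj β (δ s)) := by
  refine ⟨⟨fun p => proj β ((1 - (p.1 : ℝ)) * γ p.2 + (p.1 : ℝ) * δ p.2),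
    (continuous_proj β).comp (by fun_prop)⟩, fun s => by simp, fun s => by simp, fun r => ?_⟩
  simpa using h r r.2

/-! ### Test curves -/

/-- The conformal factor in the coordinates `x + i y`. -/
def RiemMetric.fac {β : ℝ} (g : RiemMetric β) (x y : ℝ) : ℝ := g.factor (x + y * Complex.I)

section fac
variable {β : ℝ} (g : RiemMetric β)

theorem RiemMetric.fac_pos (x y : ℝ) : 0 < g.fac x y := g.factor_pos _

theorem RiemMetric.continuous_fac : Continuous fun p : ℝ × ℝ => g.fac p.1 p.2 :=
  g.continuous_factor.comp (by fun_prop)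

@[fun_prop]
theorem RiemMetric.continuous_fac_comp {X : Type*} [TopologicalSpace X] {u v : X → ℝ}
    (hu : Continuous u) (hv : Continuous v) : Continuous fun p => g.fac (u p) (v p) :=
  g.continuous_fac.comp (hu.prodMk hv)

theorem RiemMetric.fac_add_pi (x y : ℝ) : g.fac (x + Real.pi) y = g.fac x (-y) := by
  rw [fac, fac, ← g.factor_glide (x + (-y : ℝ) * Complex.I)]
  congr 1
  apply Complex.ext
  · rw [glide_re]; simp
  · rw [glide_im]; simp

theorem RiemMetric.fac_add_two_pi (x y : ℝ) : g.fac (x + 2 * Real.pi) y = g.fac x y := by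
  rw [two_mul, ← add_assoc, fac_add_pi, fac_add_pi, neg_neg]

theorem RiemMetric.fac_add_two_mul (x y : ℝ) : g.fac x (y + 2 * β) = g.fac x y := by
  rw [fac, fac, ← g.factor_vert (x + y * Complex.I)]
  congr 1
  apply Complex.ext
  · rw [vert_re]; simp
  · rw [vert_im]; simp

variable {g}

/-- Test curve: the vertical line of abscissa x, over one period 2β. -/
theorem RiemMetric.Conformal.lv_le (hg : g.Conformal (flat β)) (hβ : 0 < β) (x : ℝ) :
    g.lv ≤ ∫ y in -β..β, g.fac x y := by
  have hd : ∀ s : ℝ, HasDerivAt (fun s : ℝ => (x : ℂ) + ((-β + 2 * β * s : ℝ) : ℂ) * Complex.I)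
      (((2 * β : ℝ) : ℂ) * Complex.I) s := by
    intro s
    have h1 : HasDerivAt (fun s : ℝ => -β + 2 * β * s) (2 * β) s := by
      simpa using ((hasDerivAt_id s).const_mul (2 * β)).const_add (-β)
    exact (h1.ofReal_comp.mul_const Complex.I).const_add _
  have hcd : ContDiff ℝ 1 (fun s : ℝ => (x : ℂ) + ((-β + 2 * β * s : ℝ) : ℂ) * Complex.I) := by
    rw [contDiff_one_iff_deriv]
    refine ⟨fun s => (hd s).differentiableAt, ?_⟩
    rw [funext fun s => (hd s).deriv]
    exact continuous_const
  have hle := g.minLength_le (c := vertLoop β) (piecewiseC1_of_contDiff hcd)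
    (freelyHomotopic_of_segment hcd.continuous
      (δ := fun s => (s : ℂ) * (2 * Complex.I * (β : ℂ))) (by fun_prop) (fun r _ => by
        rw [proj_eq_iff]
        refine ⟨0, 1, ?_, ?_⟩
        · simp
        · simp
          ring))
  refine hle.trans_eq ?_
  rw [hg.length_eq]
  have h3 := intervalIntegral.mul_integral_comp_add_mul (a := 0) (b := 1) (f := fun y => g.fac x y)
    (2 * β) (-β)
  rw [show -β + 2 * β * 0 = -β by ring, show -β + 2 * β * 1 = β by ring] at h3
  rw [← h3, ← intervalIntegral.integral_const_mul]
  refine intervalIntegral.integral_congr fun s _ => ?_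
  simp only [(hd s).deriv]
  rw [norm_mul, Complex.norm_I, mul_one, Complex.norm_real, Real.norm_of_nonneg (by positivity),
    mul_comm]
  rfl

/-- The great circle arcs of the sphere, in the Mercator projection. -/
theorem hasDerivAt_mercator_greatCircle (x c T s : ℝ) :
    HasDerivAt (fun s : ℝ => ((x + Real.pi * s : ℝ) : ℂ) +
        ((c + Real.arsinh (T * Real.sin (Real.pi * s)) : ℝ) : ℂ) * Complex.I)
      ((Real.pi : ℂ) + (((Real.sqrt (1 + (T * Real.sin (Real.pi * s)) ^ 2))⁻¹ *
        (T * (Real.cos (Real.pi * s) * Real.pi)) : ℝ) : ℂ) * Complex.I) s := by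
  have h0 : HasDerivAt (fun s : ℝ => Real.pi * s) Real.pi s := by
    simpa using (hasDerivAt_id s).const_mul Real.pi
  have h1 := h0.const_add x
  have h2 : HasDerivAt (fun s : ℝ => c + Real.arsinh (T * Real.sin (Real.pi * s)))
      ((Real.sqrt (1 + (T * Real.sin (Real.pi * s)) ^ 2))⁻¹ *
        (T * (Real.cos (Real.pi * s) * Real.pi))) s :=
    ((Real.hasDerivAt_arsinh _).comp s ((h0.sin).const_mul T)).const_add c
  exact h1.ofReal_comp.add (h2.ofReal_comp.mul_const Complex.I)

theorem norm_deriv_mercator_greatCircle (T θ : ℝ) :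
    ‖(Real.pi : ℂ) + (((Real.sqrt (1 + (T * Real.sin θ) ^ 2))⁻¹ *
        (T * (Real.cos θ * Real.pi)) : ℝ) : ℂ) * Complex.I‖ =
      Real.pi * (Real.sqrt (1 + T ^ 2) / Real.sqrt (1 + (T * Real.sin θ) ^ 2)) := by
  have hp : 0 < 1 + (T * Real.sin θ) ^ 2 := by positivity
  rw [Complex.norm_add_mul_I, ← Real.sqrt_div' _ hp.le,
    show Real.pi * √((1 + T ^ 2) / (1 + (T * Real.sin θ) ^ 2)) =
      √(Real.pi ^ 2) * √((1 + T ^ 2) / (1 + (T * Real.sin θ) ^ 2)) by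
      rw [Real.sqrt_sq Real.pi_pos.le], ← Real.sqrt_mul (sq_nonneg _)]
  congr 1
  rw [mul_pow, inv_pow, Real.sq_sqrt hp.le]
  field_simp
  have := Real.sin_sq_add_cos_sq θ
  linear_combination T ^ 2 * this

theorem contDiff_mercator_greatCircle (x c T : ℝ) :
    ContDiff ℝ 1 (fun s : ℝ => ((x + Real.pi * s : ℝ) : ℂ) +
        ((c + Real.arsinh (T * Real.sin (Real.pi * s)) : ℝ) : ℂ) * Complex.I) := by
  rw [contDiff_one_iff_deriv]
  refine ⟨fun s => (hasDerivAt_mercator_greatCircle x c T s).differentiableAt, ?_⟩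
  rw [funext fun s => (hasDerivAt_mercator_greatCircle x c T s).deriv]
  have : ∀ s : ℝ, √(1 + (T * Real.sin (Real.pi * s)) ^ 2) ≠ 0 := fun s => by positivity
  fun_prop (disch := assumption)

theorem RiemMetric.Conformal.length_greatCircle (hg : g.Conformal (flat β)) (x c T : ℝ) :
    g.length (fun s : ℝ => ((x + Real.pi * s : ℝ) : ℂ) +
        ((c + Real.arsinh (T * Real.sin (Real.pi * s)) : ℝ) : ℂ) * Complex.I) =
      ∫ θ in (0 : ℝ)..Real.pi, g.fac (x + θ) (c + Real.arsinh (T * Real.sin θ)) *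
        (Real.sqrt (1 + T ^ 2) / Real.sqrt (1 + (T * Real.sin θ) ^ 2)) := by
  rw [hg.length_eq]
  have h3 := intervalIntegral.mul_integral_comp_mul_left (a := 0) (b := 1)
    (f := fun θ => g.fac (x + θ) (c + Real.arsinh (T * Real.sin θ)) *
        (Real.sqrt (1 + T ^ 2) / Real.sqrt (1 + (T * Real.sin θ) ^ 2))) Real.pi
  rw [mul_zero, mul_one] at h3
  rw [← h3, ← intervalIntegral.integral_const_mul]
  refine intervalIntegral.integral_congr fun s _ => ?_
  simp only [(hasDerivAt_mercator_greatCircle x c T s).deriv, norm_deriv_mercator_greatCircle]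
  rw [← fac]
  ring

/-- Test curve: a great circle arc of slope T. It has height 0 at both ends, which are π apart, so σ
closes it. -/
theorem RiemMetric.Conformal.lσ_le (hg : g.Conformal (flat β)) (x T : ℝ) :
    g.lσ ≤ ∫ θ in (0 : ℝ)..Real.pi, g.fac (x + θ) (Real.arsinh (T * Real.sin θ)) *
        (Real.sqrt (1 + T ^ 2) / Real.sqrt (1 + (T * Real.sin θ) ^ 2)) := by
  have hcd := contDiff_mercator_greatCircle x 0 T
  have hle := g.minLength_le (c := glideLoop β) (piecewiseC1_of_contDiff hcd)
    (freelyHomotopic_of_segment hcd.continuous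
      (δ := fun s => (s : ℂ) * (Real.pi : ℂ)) (by fun_prop) (fun r _ => by
        rw [proj_eq_iff]
        refine ⟨1, 0, ?_, ?_⟩
        · simp
          ring
        · simp))
  rw [hg.length_greatCircle] at hle
  simp only [zero_add] at hle
  exact (min_le_left _ _).trans hle

/-- The same arc raised by β, which tσ closes since it fixes the line y = β. -/
theorem RiemMetric.Conformal.lσ_le' (hg : g.Conformal (flat β)) (x T : ℝ) :
    g.lσ ≤ ∫ θ in (0 : ℝ)..Real.pi, g.fac (x + θ) (β + Real.arsinh (T * Real.sin θ)) *
        (Real.sqrt (1 + T ^ 2) / Real.sqrt (1 + (T * Real.sin θ) ^ 2)) := by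
  have hcd := contDiff_mercator_greatCircle x β T
  have hle := g.minLength_le (c := glideLoop' β) (piecewiseC1_of_contDiff hcd)
    (freelyHomotopic_of_segment hcd.continuous
      (δ := fun s => Complex.I * (β : ℂ) + (s : ℂ) * (Real.pi : ℂ)) (by fun_prop) (fun r _ => by
        rw [proj_eq_iff]
        refine ⟨1, 1, ?_, ?_⟩
        · simp
          ring
        · simp
          ring))
  rw [hg.length_greatCircle] at hle
  exact (min_le_right _ _).trans hle

end fac

/-! ### The distribution of slopes in the calibration -/

open MeasureTheory in
/-- The fundamental theorem of calculus for a nonnegative derivative, possibly singular at the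
ends. -/
theorem setLIntegral_Ioo_ofReal_deriv {F F' : ℝ → ℝ} {a b : ℝ} (hab : a ≤ b)
    (hc : ContinuousOn F (Icc a b)) (hd : ∀ x ∈ Ioo a b, HasDerivAt F (F' x) x)
    (hpos : ∀ x ∈ Ioo a b, 0 ≤ F' x) :
    ∫⁻ x in Ioo a b, ENNReal.ofReal (F' x) = ENNReal.ofReal (F b - F a) := by
  have hi := intervalIntegral.integrableOn_deriv_of_nonneg hc hd hpos
  rw [← intervalIntegral.integral_eq_sub_of_hasDerivAt_of_le hab hc hd
    ((intervalIntegrable_iff_integrableOn_Ioc_of_le hab).2 hi),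
    intervalIntegral.integral_of_le hab, integral_Ioc_eq_integral_Ioo,
    ofReal_integral_eq_lintegral_ofReal (hi.mono_set Ioo_subset_Ioc_self)]
  exact (ae_restrict_iff' measurableSet_Ioo).2 (Filter.Eventually.of_forall hpos)

/-- The weights of the great circle arcs of slope `T` in the calibration. -/
def arcWeight (τ m q : ℝ) : ℝ :=
  1 / (Real.pi * Real.sqrt (τ ^ 2 - q)) * (Real.sqrt (1 + τ ^ 2) / (1 + q) - m)

/-- The conventions √q = 0 for q ≤ 0 and 1 / 0 = 0 extend the weight by zero outside the disc of
radius τ. -/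
theorem arcWeight_eq_zero {τ m q : ℝ} (h : τ ^ 2 ≤ q) : arcWeight τ m q = 0 := by
  rw [arcWeight, Real.sqrt_eq_zero_of_nonpos (by linarith)]
  simp

/-- On the disc q ≤ τ² the term √(1 + τ²) / (1 + q) is smallest on the boundary, where it equals the
bound imposed on m. -/
theorem arcWeight_nonneg {τ m q : ℝ} (hm : m ≤ 1 / Real.sqrt (1 + τ ^ 2)) (hq : 0 ≤ q) :
    0 ≤ arcWeight τ m q := by
  rcases le_total (τ ^ 2) q with h | h
  · rw [arcWeight_eq_zero h]
  refine mul_nonneg (by positivity) (sub_nonneg.2 (hm.trans ?_))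
  have hP : 0 < √(1 + τ ^ 2) := by positivity
  rw [div_le_div_iff₀ hP (by positivity), Real.mul_self_sqrt (by positivity)]
  linarith

theorem measurable_arcWeight (τ m : ℝ) : Measurable (arcWeight τ m) := by
  unfold arcWeight
  fun_prop

theorem hasDerivAt_arcsin_div {ρ X : ℝ} (hX : X ∈ Ioo (-ρ) ρ) :
    HasDerivAt (fun X => Real.arcsin (X / ρ)) (1 / Real.sqrt (ρ ^ 2 - X ^ 2)) X := by
  have hρ : 0 < ρ := by linarith [hX.1, hX.2]
  have h1 : X / ρ < 1 := (div_lt_one hρ).2 hX.2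
  have h2 : -1 < X / ρ := by rw [lt_div_iff₀ hρ]; linarith [hX.1]
  have h3 : HasDerivAt (fun X : ℝ => X / ρ) (1 / ρ) X := (hasDerivAt_id X).div_const ρ
  have h := (Real.hasDerivAt_arcsin h2.ne' h1.ne).comp X h3
  refine h.congr_deriv ?_
  have h4 : ρ ^ 2 - X ^ 2 = ρ ^ 2 * (1 - (X / ρ) ^ 2) := by field_simp
  rw [h4, Real.sqrt_mul (sq_nonneg _), Real.sqrt_sq hρ.le]
  field_simp

/-- With Q² = 1 + Z² and ρ² = τ² - Z², this provides an antiderivative of the first term of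
`arcWeight` along the line at height Z; `hasDerivAt_arcsin_div` provides the second. -/
theorem hasDerivAt_arcsin_mul_div {ρ Q X : ℝ} (hQ : 0 < Q) (hX : X ∈ Ioo (-ρ) ρ) :
    HasDerivAt (fun X => Real.arcsin (X * Real.sqrt (Q ^ 2 + ρ ^ 2) / (ρ * Real.sqrt (Q ^ 2 + X ^ 2))))
      (Q * Real.sqrt (Q ^ 2 + ρ ^ 2) / ((Q ^ 2 + X ^ 2) * Real.sqrt (ρ ^ 2 - X ^ 2))) X := by
  have hρ : 0 < ρ := by linarith [hX.1, hX.2]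
  have hX2 : 0 < ρ ^ 2 - X ^ 2 := by nlinarith [hX.1, hX.2]
  set P := √(Q ^ 2 + ρ ^ 2) with hP
  have hPp : 0 < P := by positivity
  have hP2 : P ^ 2 = Q ^ 2 + ρ ^ 2 := Real.sq_sqrt (by positivity)
  have hRp : 0 < √(Q ^ 2 + X ^ 2) := by positivity
  have hR2 : √(Q ^ 2 + X ^ 2) ^ 2 = Q ^ 2 + X ^ 2 := Real.sq_sqrt (by positivity)
  have hSp : 0 < √(ρ ^ 2 - X ^ 2) := Real.sqrt_pos.2 hX2
  have hS2 : √(ρ ^ 2 - X ^ 2) ^ 2 = ρ ^ 2 - X ^ 2 := Real.sq_sqrt hX2.le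
  have hR : HasDerivAt (fun X : ℝ => √(Q ^ 2 + X ^ 2)) (X / √(Q ^ 2 + X ^ 2)) X := by
    have h := (((hasDerivAt_pow 2 X).const_add (Q ^ 2)).sqrt (by positivity))
    refine h.congr_deriv ?_
    field_simp
    simp
  have hq : HasDerivAt (fun X : ℝ => X * P / (ρ * √(Q ^ 2 + X ^ 2)))
      (P * Q ^ 2 / (ρ * √(Q ^ 2 + X ^ 2) ^ 3)) X := by
    have h := ((hasDerivAt_id X).mul_const P).div (hR.const_mul ρ) (by positivity)
    refine h.congr_deriv ?_
    simp only [id]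
    field_simp
    rw [hR2]
    ring
  have hone : 1 - (X * P / (ρ * √(Q ^ 2 + X ^ 2))) ^ 2 =
      (Q * √(ρ ^ 2 - X ^ 2) / (ρ * √(Q ^ 2 + X ^ 2))) ^ 2 := by
    rw [div_pow, div_pow, mul_pow, mul_pow, mul_pow, hP2, hR2, hS2]
    field_simp
    ring
  have hlt : (X * P / (ρ * √(Q ^ 2 + X ^ 2))) ^ 2 < 1 := by
    have : 0 < (Q * √(ρ ^ 2 - X ^ 2) / (ρ * √(Q ^ 2 + X ^ 2))) ^ 2 := by positivity
    linarith
  have habs := abs_lt.1 ((sq_lt_one_iff_abs_lt_one _).1 hlt)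
  refine ((Real.hasDerivAt_arcsin habs.1.ne' habs.2.ne).comp X hq).congr_deriv ?_
  rw [hone, Real.sqrt_sq (by positivity), ← hR2]
  field_simp
  rw [Real.sqrt_sq hRp.le]

open MeasureTheory in
-- This is the equation that dictates the formula for `arcWeight`: the marginal of the radial
-- density on the Z axis is the part of the profile that vertical lines do not account for, in the
-- variable Z = sinh y.
theorem lintegral_arcWeight_line {τ m Z : ℝ} (hm : m ≤ 1 / Real.sqrt (1 + τ ^ 2))
    (hZ : Z ^ 2 < τ ^ 2) :
    ∫⁻ X : ℝ, ENNReal.ofReal (arcWeight τ m (X ^ 2 + Z ^ 2)) =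
      ENNReal.ofReal (1 / Real.sqrt (1 + Z ^ 2) - m) := by
  set ρ := √(τ ^ 2 - Z ^ 2) with hρdef
  have hρ : 0 < ρ := Real.sqrt_pos.2 (by linarith)
  have hρ2 : ρ ^ 2 = τ ^ 2 - Z ^ 2 := Real.sq_sqrt (by linarith)
  set Q := √(1 + Z ^ 2) with hQdef
  have hQ : 0 < Q := by positivity
  have hQ2 : Q ^ 2 = 1 + Z ^ 2 := Real.sq_sqrt (by positivity)
  have hsupp : ∫⁻ X : ℝ, ENNReal.ofReal (arcWeight τ m (X ^ 2 + Z ^ 2)) =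
      ∫⁻ X in Ioo (-ρ) ρ, ENNReal.ofReal (arcWeight τ m (X ^ 2 + Z ^ 2)) := by
    rw [← lintegral_indicator measurableSet_Ioo]
    congr 1
    funext X
    by_cases hX : X ∈ Ioo (-ρ) ρ
    · rw [indicator_of_mem hX]
    · rw [indicator_of_notMem hX, arcWeight_eq_zero, ENNReal.ofReal_zero]
      have : ρ ^ 2 ≤ X ^ 2 := by
        by_contra! h
        exact hX (abs_lt.1 (abs_lt_of_sq_lt_sq h hρ.le))
      linarith
  rw [hsupp]
  have hPeq : √(Q ^ 2 + ρ ^ 2) = √(1 + τ ^ 2) := by rw [hQ2, hρ2]; ring_nf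
  let F : ℝ → ℝ := fun X => 1 / Real.pi * (1 / Q *
    Real.arcsin (X * √(Q ^ 2 + ρ ^ 2) / (ρ * √(Q ^ 2 + X ^ 2))) - m * Real.arcsin (X / ρ))
  have h := setLIntegral_Ioo_ofReal_deriv (F := F) (a := -ρ) (b := ρ)
    (F' := fun X => arcWeight τ m (X ^ 2 + Z ^ 2)) (by linarith) ?_ ?_ ?_
  · rw [h]
    congr 1
    have h1 : ρ * √(Q ^ 2 + ρ ^ 2) / (ρ * √(Q ^ 2 + ρ ^ 2)) = 1 := div_self (by positivity)
    simp only [F]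
    rw [neg_sq, neg_mul, neg_div, neg_div, h1, div_self hρ.ne', Real.arcsin_neg, Real.arcsin_one]
    field_simp
    ring
  · have : ∀ X : ℝ, ρ * √(Q ^ 2 + X ^ 2) ≠ 0 := fun X => by positivity
    have h3 : Continuous fun X : ℝ => X * √(Q ^ 2 + ρ ^ 2) / (ρ * √(Q ^ 2 + X ^ 2)) := by
      fun_prop (disch := assumption)
    exact (((Real.continuous_arcsin.comp h3).const_mul _ |>.sub
      ((Real.continuous_arcsin.comp (continuous_id.div_const ρ)).const_mul m)).const_mul
        _).continuousOn
  · intro X hX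
    refine ((((hasDerivAt_arcsin_mul_div hQ hX).const_mul (1 / Q)).sub
      ((hasDerivAt_arcsin_div hX).const_mul m)).const_mul (1 / Real.pi)).congr_deriv ?_
    have hX2 : 0 < ρ ^ 2 - X ^ 2 := by nlinarith [hX.1, hX.2]
    rw [arcWeight, hPeq, show τ ^ 2 - (X ^ 2 + Z ^ 2) = ρ ^ 2 - X ^ 2 by rw [hρ2]; ring,
      show 1 + (X ^ 2 + Z ^ 2) = Q ^ 2 + X ^ 2 by rw [hQ2]; ring]
    have := Real.sqrt_pos.2 hX2
    field_simp
  · intro X _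
    exact arcWeight_nonneg hm (by positivity)

open MeasureTheory in
-- The total contribution of the arcs: the bound on each circle of radius T carries a factor 1 / √(1
-- + T²), which is integrated here against the density T dT. The result is the coefficient of l_σ,
-- up to a constant.
theorem lintegral_arcWeight_radial {τ m : ℝ} (hτ : 0 < τ) (hm : m ≤ 1 / Real.sqrt (1 + τ ^ 2)) :
    ∫⁻ T in Ioo 0 τ, ENNReal.ofReal (T * arcWeight τ m (T ^ 2) / Real.sqrt (1 + T ^ 2)) =
      ENNReal.ofReal (1 / Real.pi * (τ / Real.sqrt (1 + τ ^ 2) - m * Real.arctan τ)) := by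
  set P := √(1 + τ ^ 2) with hPdef
  have hP : 0 < P := by positivity
  have hP2 : P ^ 2 = 1 + τ ^ 2 := Real.sq_sqrt (by positivity)
  let F : ℝ → ℝ := fun T => 1 / Real.pi * (m * Real.arcsin (√(τ ^ 2 - T ^ 2) / P) -
    √(τ ^ 2 - T ^ 2) / (P * √(1 + T ^ 2)))
  have h := setLIntegral_Ioo_ofReal_deriv (F := F) (a := 0) (b := τ)
    (F' := fun T => T * arcWeight τ m (T ^ 2) / √(1 + T ^ 2)) hτ.le ?_ ?_ ?_
  · rw [h]
    congr 1
    simp only [F]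
    rw [sub_self, Real.sqrt_zero, zero_div, zero_div, Real.arcsin_zero, Real.arctan_eq_arcsin]
    norm_num
    rw [Real.sqrt_sq hτ.le]
    ring
  · have : ∀ T : ℝ, P * √(1 + T ^ 2) ≠ 0 := fun T => by positivity
    have h3 : Continuous fun T : ℝ => √(τ ^ 2 - T ^ 2) / (P * √(1 + T ^ 2)) := by
      fun_prop (disch := assumption)
    have h4 : Continuous fun T : ℝ => √(τ ^ 2 - T ^ 2) / P := by fun_prop
    exact ((((Real.continuous_arcsin.comp h4).const_mul m).sub h3).const_mul _).continuousOn
  · intro T hT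
    have hT2 : 0 < τ ^ 2 - T ^ 2 := by nlinarith [hT.1, hT.2]
    set S := √(τ ^ 2 - T ^ 2) with hSdef
    have hS : 0 < S := Real.sqrt_pos.2 hT2
    have hS2 : S ^ 2 = τ ^ 2 - T ^ 2 := Real.sq_sqrt hT2.le
    set R := √(1 + T ^ 2) with hRdef
    have hR : 0 < R := by positivity
    have hR2 : R ^ 2 = 1 + T ^ 2 := Real.sq_sqrt (by positivity)
    have dS : HasDerivAt (fun T : ℝ => √(τ ^ 2 - T ^ 2)) (-T / S) T := by
      have h := (((hasDerivAt_pow 2 T).const_sub (τ ^ 2)).sqrt hT2.ne')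
      refine h.congr_deriv ?_
      rw [← hSdef]
      field_simp
      simp
    have dR : HasDerivAt (fun T : ℝ => √(1 + T ^ 2)) (T / R) T := by
      have h := (((hasDerivAt_pow 2 T).const_add 1).sqrt (by positivity))
      refine h.congr_deriv ?_
      rw [← hRdef]
      field_simp
      simp
    have hone : 1 - (S / P) ^ 2 = (R / P) ^ 2 := by
      rw [div_pow, div_pow, hS2, hR2]
      field_simp
      rw [hP2]
      ring
    have hlt : (S / P) ^ 2 < 1 := by
      have : 0 < (R / P) ^ 2 := by positivity
      linarith
    have habs := abs_lt.1 ((sq_lt_one_iff_abs_lt_one _).1 hlt)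
    have d1 := (Real.hasDerivAt_arcsin habs.1.ne' habs.2.ne).comp T (dS.div_const P)
    have d2 := dS.div (dR.const_mul P) (by positivity)
    refine (((d1.const_mul m).sub d2).const_mul (1 / Real.pi)).congr_deriv ?_
    rw [hone, Real.sqrt_sq (by positivity), arcWeight, ← hSdef, ← hPdef, ← hRdef, ← hR2]
    field_simp
    have e1 : P ^ 2 = R ^ 2 + S ^ 2 := by rw [hP2, hR2, hS2]; ring
    ring_nf
    ring_nf at e1
    simp only [e1]
    ring
  · intro T hT
    exact div_nonneg (mul_nonneg hT.1.le (arcWeight_nonneg hm (by positivity))) (by positivity)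

open MeasureTheory in
theorem lintegral_arcWeight_plane {K : ℝ → ℝ} (hK : Continuous K) {τ m : ℝ}
    (hτ : 0 < τ) (hm : m ≤ 1 / Real.sqrt (1 + τ ^ 2)) :
    ∫⁻ p : ℝ × ℝ, ENNReal.ofReal (K p.2) * ENNReal.ofReal (arcWeight τ m (p.1 ^ 2 + p.2 ^ 2)) =
      ∫⁻ Z in Ioo (-τ) τ,
        ENNReal.ofReal (K Z) * ENNReal.ofReal (1 / Real.sqrt (1 + Z ^ 2) - m) := by
  have hmeas : Measurable fun p : ℝ × ℝ =>
      ENNReal.ofReal (K p.2) * ENNReal.ofReal (arcWeight τ m (p.1 ^ 2 + p.2 ^ 2)) :=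
    (ENNReal.measurable_ofReal.comp (hK.measurable.comp measurable_snd)).mul
      (ENNReal.measurable_ofReal.comp ((measurable_arcWeight τ m).comp (by fun_prop)))
  rw [Measure.volume_eq_prod, lintegral_prod_symm _ hmeas.aemeasurable,
    ← lintegral_indicator measurableSet_Ioo]
  congr 1
  funext Z
  dsimp only
  rw [lintegral_const_mul' _ _ ENNReal.ofReal_ne_top]
  by_cases hZ : Z ∈ Ioo (-τ) τ
  · rw [indicator_of_mem hZ, lintegral_arcWeight_line hm (sq_lt_sq' hZ.1 hZ.2)]
  · rw [indicator_of_notMem hZ]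
    have hZ2 : τ ^ 2 ≤ Z ^ 2 := by
      by_contra! h
      exact hZ (abs_lt.1 (abs_lt_of_sq_lt_sq h hτ.le))
    have : ∀ X : ℝ, arcWeight τ m (X ^ 2 + Z ^ 2) = 0 := fun X =>
      arcWeight_eq_zero (by nlinarith [sq_nonneg X])
    simp [this]

open MeasureTheory in
/-- If all the averages of `K` over circles of radius `T` are bounded from below, so is a
weighted integral of `K`. -/
theorem le_integral_of_le_circle {K : ℝ → ℝ} (hK : Continuous K) (hK0 : ∀ Z, 0 ≤ K Z) {τ m C : ℝ}
    (hτ : 0 < τ) (hm : m ≤ 1 / Real.sqrt (1 + τ ^ 2)) (hC : 0 ≤ C)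
    (h : ∀ T ∈ Ioo 0 τ, C / Real.sqrt (1 + T ^ 2) ≤
      ∫ θ in -Real.pi..Real.pi, K (T * Real.sin θ)) :
    C * (1 / Real.pi * (τ / Real.sqrt (1 + τ ^ 2) - m * Real.arctan τ)) ≤
      ∫ Z in -τ..τ, K Z * (1 / Real.sqrt (1 + Z ^ 2) - m) := by
  have hW : ∀ Z ∈ Icc (-τ) τ, 0 ≤ 1 / √(1 + Z ^ 2) - m := by
    intro Z hZ
    refine sub_nonneg.2 (hm.trans ?_)
    exact one_div_le_one_div_of_le (by positivity) (Real.sqrt_le_sqrt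
      (by nlinarith [hZ.1, hZ.2]))
  have hWc : Continuous fun Z : ℝ => K Z * (1 / √(1 + Z ^ 2) - m) := by
    have : ∀ Z : ℝ, √(1 + Z ^ 2) ≠ 0 := fun Z => by positivity
    fun_prop (disch := assumption)
  have hR0 : 0 ≤ ∫ Z in -τ..τ, K Z * (1 / √(1 + Z ^ 2) - m) :=
    intervalIntegral.integral_nonneg (by linarith) fun Z hZ => mul_nonneg (hK0 Z) (hW Z hZ)
  rw [← ENNReal.ofReal_le_ofReal_iff hR0]
  have hR : ENNReal.ofReal (∫ Z in -τ..τ, K Z * (1 / √(1 + Z ^ 2) - m)) =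
      ∫⁻ p : ℝ × ℝ,
        ENNReal.ofReal (K p.2) * ENNReal.ofReal (arcWeight τ m (p.1 ^ 2 + p.2 ^ 2)) := by
    rw [lintegral_arcWeight_plane hK hτ hm, intervalIntegral.integral_of_le (by linarith),
      integral_Ioc_eq_integral_Ioo, ofReal_integral_eq_lintegral_ofReal
        ((hWc.integrableOn_Icc).mono_set Ioo_subset_Icc_self)
        ((ae_restrict_iff' measurableSet_Ioo).2 (Filter.Eventually.of_forall fun Z hZ =>
          mul_nonneg (hK0 Z) (hW Z (Ioo_subset_Icc_self hZ))))]
    simp only [ENNReal.ofReal_mul (hK0 _)]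
  -- The planar integral computed line by line is now computed circle by circle, where the
  -- hypothesis applies.
  rw [hR, ← lintegral_comp_polarCoord_symm, polarCoord_target, Measure.volume_eq_prod,
    ← Measure.prod_restrict]
  have hmeas : Measurable fun p : ℝ × ℝ => ENNReal.ofReal p.1 •
      (ENNReal.ofReal (K (polarCoord.symm p).2) *
        ENNReal.ofReal (arcWeight τ m ((polarCoord.symm p).1 ^ 2 + (polarCoord.symm p).2 ^ 2))) := by
    simp only [polarCoord_symm_apply, smul_eq_mul]
    exact (ENNReal.measurable_ofReal.comp measurable_fst).mul
      ((ENNReal.measurable_ofReal.comp (hK.measurable.comp (by fun_prop))).mul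
      (ENNReal.measurable_ofReal.comp ((measurable_arcWeight τ m).comp (by fun_prop))))
  rw [lintegral_prod _ hmeas.aemeasurable, ENNReal.ofReal_mul hC,
    ← lintegral_arcWeight_radial hτ hm, ← lintegral_const_mul' _ _ ENNReal.ofReal_ne_top]
  refine (lintegral_mono_ae ?_).trans (lintegral_mono_set (μ := volume)
    (show Ioo 0 τ ⊆ Ioi 0 from Ioo_subset_Ioi_self))
  refine (ae_restrict_iff' measurableSet_Ioo).2 (Filter.Eventually.of_forall fun T hT => ?_)
  have hD := arcWeight_nonneg hm (sq_nonneg T)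
  have hpolar : ∀ θ : ℝ, (polarCoord.symm (T, θ)).1 ^ 2 + (polarCoord.symm (T, θ)).2 ^ 2 =
      T ^ 2 := by
    intro θ
    rw [polarCoord_symm_apply]
    linear_combination T ^ 2 * Real.sin_sq_add_cos_sq θ
  simp only [hpolar]
  have hKc : Continuous fun θ => K (T * Real.sin θ) := by fun_prop
  calc ENNReal.ofReal C * ENNReal.ofReal (T * arcWeight τ m (T ^ 2) / √(1 + T ^ 2))
      = ENNReal.ofReal (T * arcWeight τ m (T ^ 2)) * ENNReal.ofReal (C / √(1 + T ^ 2)) := by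
        rw [← ENNReal.ofReal_mul hC, ← ENNReal.ofReal_mul (mul_nonneg hT.1.le hD)]
        congr 1
        ring
    _ ≤ ENNReal.ofReal (T * arcWeight τ m (T ^ 2)) *
          ENNReal.ofReal (∫ θ in -Real.pi..Real.pi, K (T * Real.sin θ)) := by
        gcongr
        exact h T hT
    _ = ENNReal.ofReal (T * arcWeight τ m (T ^ 2)) *
          ∫⁻ θ in Ioo (-Real.pi) Real.pi, ENNReal.ofReal (K (T * Real.sin θ)) := by
        rw [intervalIntegral.integral_of_le (by linarith [Real.pi_pos]),
          integral_Ioc_eq_integral_Ioo, ofReal_integral_eq_lintegral_ofReal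
            ((hKc.integrableOn_Icc).mono_set Ioo_subset_Icc_self)
            (Filter.Eventually.of_forall fun θ => hK0 _)]
    _ = ∫⁻ θ in Ioo (-Real.pi) Real.pi, ENNReal.ofReal (T * arcWeight τ m (T ^ 2)) *
          ENNReal.ofReal (K (T * Real.sin θ)) :=
        (lintegral_const_mul' _ _ ENNReal.ofReal_ne_top).symm
    _ = _ := by
        refine lintegral_congr fun θ => ?_
        rw [polarCoord_symm_apply, smul_eq_mul, ENNReal.ofReal_mul hT.1.le]
        ring

/-! ### Averages over horizontal translations -/

open MeasureTheory in
theorem integral_integral_swap_of_continuous {f : ℝ × ℝ → ℝ} (hf : Continuous f) (a b c d : ℝ) :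
    ∫ x in a..b, ∫ y in c..d, f (x, y) = ∫ y in c..d, ∫ x in a..b, f (x, y) := by
  refine intervalIntegral_intervalIntegral_swap (F := fun x y => f (x, y)) ?_
  exact (hf.continuousOn.integrableOn_compact (isCompact_uIcc.prod isCompact_uIcc)).mono_set
    (prod_mono uIoc_subset_uIcc uIoc_subset_uIcc)

open MeasureTheory in
theorem setIntegral_Ico_reProdIm_Ico {f : ℂ → ℝ} (hf : Continuous f) {a b c d : ℝ} (hab : a ≤ b)
    (hcd : c ≤ d) :
    ∫ z in Ico a b ×ℂ Ico c d, f z = ∫ y in c..d, ∫ x in a..b, f (x + y * Complex.I) := by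
  have e := Complex.volume_preserving_equiv_real_prod.symm
  rw [← e.setIntegral_preimage_emb (MeasurableEquiv.measurableEmbedding _)]
  have hpre : Complex.measurableEquivRealProd.symm ⁻¹' (Ico a b ×ℂ Ico c d) =
      Ico a b ×ˢ Ico c d := by
    ext p
    simp [Complex.mem_reProdIm]
  have hsymm : ∀ p : ℝ × ℝ, Complex.measurableEquivRealProd.symm p = p.1 + p.2 * Complex.I :=
    fun p => Complex.ext (by simp) (by simp)
  have hc : Continuous fun p : ℝ × ℝ => f (p.1 + p.2 * Complex.I) := hf.comp (by fun_prop)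
  simp only [hsymm]
  rw [hpre, Measure.volume_eq_prod, setIntegral_prod _ ((hc.continuousOn.integrableOn_compact
    (isCompact_Icc.prod isCompact_Icc)).mono_set (prod_mono Ico_subset_Icc_self
      Ico_subset_Icc_self)), ← integral_integral_swap_of_continuous hc]
  simp only [intervalIntegral.integral_of_le hab, intervalIntegral.integral_of_le hcd,
    integral_Ico_eq_integral_Ioo, integral_Ioc_eq_integral_Ioo]

section average
variable {β : ℝ} (g : RiemMetric β)

/-- The integral of the conformal factor along horizontal lines. -/
def RiemMetric.avg (y : ℝ) : ℝ := ∫ x in (0 : ℝ)..(2 * Real.pi), g.fac x y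

@[fun_prop]
theorem RiemMetric.continuous_avg : Continuous g.avg :=
  intervalIntegral.continuous_parametric_intervalIntegral_of_continuous'
    (f := fun y x => g.fac x y) (by
      show Continuous fun p : ℝ × ℝ => g.fac p.2 p.1
      fun_prop) _ _

theorem RiemMetric.avg_nonneg (y : ℝ) : 0 ≤ g.avg y :=
  intervalIntegral.integral_nonneg (by positivity) fun _ _ => (g.fac_pos _ _).le

theorem RiemMetric.integral_fac_add (x₀ y : ℝ) :
    ∫ x in (0 : ℝ)..(2 * Real.pi), g.fac (x + x₀) y = g.avg y := by
  have hper : Function.Periodic (fun x => g.fac x y) (2 * Real.pi) := fun x => g.fac_add_two_pi x y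
  have h := hper.intervalIntegral_add_eq x₀ 0
  rw [intervalIntegral.integral_comp_add_right (f := fun x => g.fac x y), zero_add, add_comm, h,
    zero_add, avg]

/-- A glide shifts by half of the period 2π, which the average does not see, and reflects y. -/
theorem RiemMetric.avg_neg (y : ℝ) : g.avg (-y) = g.avg y := by
  rw [← g.integral_fac_add Real.pi y, avg]
  simp only [fac_add_pi]

theorem RiemMetric.avg_add_two_mul (y : ℝ) : g.avg (y + 2 * β) = g.avg y := by
  simp only [avg, fac_add_two_mul]

/-- The sum of the integrals along two horizontal lines at distance `β`. -/
def RiemMetric.avg₂ (y : ℝ) : ℝ := g.avg y + g.avg (β + y)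

@[fun_prop]
theorem RiemMetric.continuous_avg₂ : Continuous g.avg₂ := by
  unfold avg₂
  fun_prop

theorem RiemMetric.avg₂_nonneg (y : ℝ) : 0 ≤ g.avg₂ y := add_nonneg (g.avg_nonneg _) (g.avg_nonneg _)

theorem RiemMetric.avg₂_neg (y : ℝ) : g.avg₂ (-y) = g.avg₂ y := by
  have h : g.avg (β + -y) = g.avg (β + y) := by
    rw [← g.avg_neg, ← g.avg_add_two_mul]
    congr 1
    ring
  rw [avg₂, avg₂, avg_neg, h]

/-- The weight has period β while `avg` has period 2β only, so the two halves of a period of `avg`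
can be folded onto each other. -/
theorem RiemMetric.integral_avg₂_mul {w : ℝ → ℝ} (hw : Continuous w) (hper : Function.Periodic w β) :
    ∫ y in -(β / 2)..(β / 2), g.avg₂ y * w y = ∫ y in -β..β, g.avg y * w y := by
  have hp : Function.Periodic (fun y => g.avg y * w y) (2 * β) := fun y => by
    have hw2 : w (y + 2 * β) = w y := by
      rw [two_mul, ← add_assoc, hper, hper]
    simp only [avg_add_two_mul, hw2]
  have h1 := hp.intervalIntegral_add_eq (-β) (-(β / 2))
  have hc : Continuous fun y => g.avg y * w y := by fun_prop
  rw [show -β + 2 * β = β by ring] at h1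
  rw [h1, ← intervalIntegral.integral_add_adjacent_intervals
    (hc.intervalIntegrable _ (β / 2)) (hc.intervalIntegrable _ _)]
  have h2 := intervalIntegral.integral_comp_add_left (a := -(β / 2)) (b := β / 2)
    (f := fun y => g.avg y * w y) β
  rw [show β + -(β / 2) = β / 2 by ring, show β + β / 2 = -(β / 2) + 2 * β by ring] at h2
  rw [← h2, ← intervalIntegral.integral_add (hc.intervalIntegrable _ _)
    (Continuous.intervalIntegrable (by fun_prop) _ _)]
  refine intervalIntegral.integral_congr fun y _ => ?_
  have : w (β + y) = w y := by rw [add_comm, hper]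
  simp only [avg₂, this]
  ring

variable {g}

theorem RiemMetric.Conformal.two_pi_mul_lv_le (hg : g.Conformal (flat β)) (hβ : 0 < β) :
    2 * Real.pi * g.lv ≤ ∫ y in -(β / 2)..(β / 2), g.avg₂ y := by
  have h1 := g.integral_avg₂_mul (w := fun _ => 1) continuous_const (fun _ => rfl)
  simp only [mul_one] at h1
  have h2 := integral_integral_swap_of_continuous g.continuous_fac 0 (2 * Real.pi) (-β) β
  simp only at h2
  rw [h1]
  simp only [avg]
  rw [← h2]
  calc 2 * Real.pi * g.lv = ∫ _ in (0 : ℝ)..(2 * Real.pi), g.lv := by simp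
    _ ≤ _ := intervalIntegral.integral_mono_on (by positivity) (by simp)
      (Continuous.intervalIntegrable
        (intervalIntegral.continuous_parametric_intervalIntegral_of_continuous'
          (f := fun x y => g.fac x y) g.continuous_fac _ _) _ _)
      (fun x _ => hg.lv_le hβ x)

/-- Integrating over all horizontal translates of one curve and exchanging the integrals replaces
the conformal factor by its horizontal average. -/
theorem le_integral_avg_of_forall_le {B : ℝ} {u q : ℝ → ℝ} (hu : Continuous u) (hq : Continuous q)
    (h : ∀ x, B ≤ ∫ θ in (0 : ℝ)..Real.pi, g.fac (x + θ) (u θ) * q θ) :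
    2 * Real.pi * B ≤ ∫ θ in (0 : ℝ)..Real.pi, g.avg (u θ) * q θ := by
  have hc : Continuous fun p : ℝ × ℝ => g.fac (p.1 + p.2) (u p.2) * q p.2 := by fun_prop
  have h2 := integral_integral_swap_of_continuous hc 0 (2 * Real.pi) 0 Real.pi
  simp only [intervalIntegral.integral_mul_const, g.integral_fac_add] at h2
  rw [← h2]
  calc 2 * Real.pi * B = ∫ _ in (0 : ℝ)..(2 * Real.pi), B := by simp
    _ ≤ _ := intervalIntegral.integral_mono_on (by positivity) (by simp)
      (Continuous.intervalIntegrable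
        (intervalIntegral.continuous_parametric_intervalIntegral_of_continuous'
          (f := fun x θ => g.fac (x + θ) (u θ) * q θ) hc _ _) _ _)
      (fun x _ => h x)

/-- Sum of the averaged inequalities for the arcs around y = 0 and around y = β; each of the two
classes has minimal length at least l_σ. -/
theorem RiemMetric.Conformal.four_pi_mul_lσ_le (hg : g.Conformal (flat β)) (T : ℝ) :
    4 * Real.pi * g.lσ ≤ ∫ θ in (0 : ℝ)..Real.pi, g.avg₂ (Real.arsinh (T * Real.sin θ)) *
        (Real.sqrt (1 + T ^ 2) / Real.sqrt (1 + (T * Real.sin θ) ^ 2)) := by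
  have hq : Continuous fun θ : ℝ => √(1 + T ^ 2) / √(1 + (T * Real.sin θ) ^ 2) := by
    have : ∀ θ : ℝ, √(1 + (T * Real.sin θ) ^ 2) ≠ 0 := fun θ => by positivity
    fun_prop (disch := assumption)
  have hu : Continuous fun θ : ℝ => Real.arsinh (T * Real.sin θ) :=
    Real.continuous_arsinh.comp (by fun_prop)
  have h1 := le_integral_avg_of_forall_le hu hq (fun x => hg.lσ_le x T)
  have h2 := le_integral_avg_of_forall_le (hu.const_add β) hq (fun x => hg.lσ_le' x T)
  simp only [avg₂, add_mul]
  rw [intervalIntegral.integral_add (Continuous.intervalIntegrable (by fun_prop) _ _)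
    (Continuous.intervalIntegrable (by fun_prop) _ _)]
  linarith

end average

/-! ### The upper bound -/

section upper
variable {β : ℝ} {g : RiemMetric β}

theorem RiemMetric.lσ_nonneg (g : RiemMetric β) : 0 ≤ g.lσ :=
  le_min (g.minLength_nonneg _) (g.minLength_nonneg _)

theorem RiemMetric.lv_nonneg (g : RiemMetric β) : 0 ≤ g.lv := g.minLength_nonneg _

/-- The substitution Z = sinh y turns the averaged arc of slope T into half a circle of radius T.
Evenness of `avg₂` supplies the other half, so that `le_integral_of_le_circle` applies. -/
theorem RiemMetric.Conformal.le_integral_avg₂_arcs (hg : g.Conformal (flat β)) {τ m : ℝ}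
    (hτ : 0 < τ) (hm : m ≤ 1 / Real.sqrt (1 + τ ^ 2)) :
    8 * (τ / Real.sqrt (1 + τ ^ 2) - m * Real.arctan τ) * g.lσ ≤
      ∫ y in -Real.arsinh τ..Real.arsinh τ, g.avg₂ y * (1 / Real.cosh y - m) := by
  let K : ℝ → ℝ := fun Z => g.avg₂ (Real.arsinh Z) / √(1 + Z ^ 2)
  have hne : ∀ Z : ℝ, √(1 + Z ^ 2) ≠ 0 := fun Z => by positivity
  have hK : Continuous K :=
    (g.continuous_avg₂.comp Real.continuous_arsinh).div (by fun_prop) hne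
  have hK0 : ∀ Z, 0 ≤ K Z := fun Z => div_nonneg (g.avg₂_nonneg _) (Real.sqrt_nonneg _)
  have hKneg : ∀ Z, K (-Z) = K Z := fun Z => by
    simp only [K, Real.arsinh_neg, avg₂_neg, neg_sq]
  have hcirc : ∀ T ∈ Ioo 0 τ, 8 * Real.pi * g.lσ / √(1 + T ^ 2) ≤
      ∫ θ in -Real.pi..Real.pi, K (T * Real.sin θ) := by
    intro T _
    have hc : Continuous fun θ => K (T * Real.sin θ) := by fun_prop
    have h1 := hg.four_pi_mul_lσ_le T
    have h2 : ∫ θ in (0 : ℝ)..Real.pi, g.avg₂ (Real.arsinh (T * Real.sin θ)) *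
        (√(1 + T ^ 2) / √(1 + (T * Real.sin θ) ^ 2)) =
        √(1 + T ^ 2) * ∫ θ in (0 : ℝ)..Real.pi, K (T * Real.sin θ) := by
      rw [← intervalIntegral.integral_const_mul]
      refine intervalIntegral.integral_congr fun θ _ => ?_
      simp only [K]
      ring
    have h3 : ∫ θ in -Real.pi..0, K (T * Real.sin θ) =
        ∫ θ in (0 : ℝ)..Real.pi, K (T * Real.sin θ) := by
      have := intervalIntegral.integral_comp_neg (a := 0) (b := Real.pi)
        (f := fun θ => K (T * Real.sin θ))
      simp only [Real.sin_neg, mul_neg, hKneg, neg_zero] at this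
      exact this.symm
    rw [← intervalIntegral.integral_add_adjacent_intervals (hc.intervalIntegrable _ 0)
      (hc.intervalIntegrable _ _), h3, div_le_iff₀ (by positivity)]
    rw [h2] at h1
    linarith
  have h := le_integral_of_le_circle hK hK0 hτ hm
    (mul_nonneg (by positivity) g.lσ_nonneg) hcirc
  have hsub := intervalIntegral.integral_comp_mul_deriv (a := -Real.arsinh τ) (b := Real.arsinh τ)
    (f := Real.sinh) (f' := Real.cosh) (g := fun Z => K Z * (1 / √(1 + Z ^ 2) - m))
    (fun x _ => Real.hasDerivAt_sinh x) Real.continuous_cosh.continuousOn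
    (hK.mul ((continuous_const.div (by fun_prop) hne).sub continuous_const))
  rw [Real.sinh_neg, Real.sinh_arsinh] at hsub
  rw [← hsub] at h
  calc _ = 8 * Real.pi * g.lσ * (1 / Real.pi * (τ / √(1 + τ ^ 2) - m * Real.arctan τ)) := by
        field_simp
    _ ≤ _ := h
    _ = _ := by
        refine intervalIntegral.integral_congr fun y _ => ?_
        have hch : √(1 + Real.sinh y ^ 2) = Real.cosh y := by
          rw [add_comm, ← Real.cosh_sq, Real.sqrt_sq (Real.cosh_pos y).le]
        have := (Real.cosh_pos y).ne'
        simp only [Function.comp_apply, K, Real.arsinh_sinh, hch]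
        field_simp

/-- Decompose w = m + (w - m): vertical lines carry the constant part, and arcs carry the rest on
|y| ≤ arsinh τ. -/
theorem RiemMetric.Conformal.le_integral_avg_mul (hg : g.Conformal (flat β)) (hβ : 0 < β)
    {τ m : ℝ} (hτ : 0 < τ) (hm0 : 0 ≤ m) (hm : m ≤ 1 / Real.sqrt (1 + τ ^ 2))
    (hL : Real.arsinh τ ≤ β / 2) {w : ℝ → ℝ} (hw : Continuous w) (hper : Function.Periodic w β)
    (hmw : ∀ y, m ≤ w y) (hcosh : ∀ y, |y| ≤ Real.arsinh τ → w y = 1 / Real.cosh y) :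
    2 * Real.pi * m * g.lv + 8 * (τ / Real.sqrt (1 + τ ^ 2) - m * Real.arctan τ) * g.lσ ≤
      ∫ y in -β..β, g.avg y * w y := by
  have hL0 : 0 < Real.arsinh τ := Real.arsinh_pos_iff.2 hτ
  have hc1 : Continuous fun y => g.avg₂ y * m := by fun_prop
  have hc2 : Continuous fun y => g.avg₂ y * (w y - m) := by fun_prop
  have h1 := hg.two_pi_mul_lv_le hβ
  have h2 := hg.le_integral_avg₂_arcs hτ hm
  have h3 : ∫ y in -Real.arsinh τ..Real.arsinh τ, g.avg₂ y * (1 / Real.cosh y - m) =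
      ∫ y in -Real.arsinh τ..Real.arsinh τ, g.avg₂ y * (w y - m) := by
    refine intervalIntegral.integral_congr fun y hy => ?_
    rw [uIcc_of_le (by linarith)] at hy
    simp only [hcosh y (abs_le.2 hy)]
  -- Beyond the reach of the arcs the nonnegative excess w - m is simply dropped. For the
  -- flat-spherical choice it vanishes there, so nothing is lost.
  have h4 : ∫ y in -Real.arsinh τ..Real.arsinh τ, g.avg₂ y * (w y - m) ≤
      ∫ y in -(β / 2)..(β / 2), g.avg₂ y * (w y - m) :=
    intervalIntegral.integral_mono_interval (by linarith) (by linarith) hL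
      (Filter.Eventually.of_forall fun y => mul_nonneg (g.avg₂_nonneg y) (sub_nonneg.2 (hmw y)))
      (hc2.intervalIntegrable _ _)
  have h5 : ∫ y in -(β / 2)..(β / 2), g.avg₂ y * w y =
      (∫ y in -(β / 2)..(β / 2), g.avg₂ y) * m +
        ∫ y in -(β / 2)..(β / 2), g.avg₂ y * (w y - m) := by
    rw [← intervalIntegral.integral_mul_const, ← intervalIntegral.integral_add
      (hc1.intervalIntegrable _ _) (hc2.intervalIntegrable _ _)]
    refine intervalIntegral.integral_congr fun y _ => ?_
    ring
  rw [← g.integral_avg₂_mul hw hper, h5]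
  have h6 := mul_le_mul_of_nonneg_right h1 hm0
  linarith

theorem RiemMetric.Conformal.vol_eq_integral (hg : g.Conformal (flat β)) (hβ : 0 < β) :
    g.vol = ∫ y in -β..β, ∫ x in (0 : ℝ)..Real.pi, g.fac x y ^ 2 := by
  rw [hg.vol_eq, setIntegral_Ico_reProdIm_Ico (f := fun z => g.factor z ^ 2)
    (g.continuous_factor.pow 2) Real.pi_pos.le
    (by linarith)]
  rfl

theorem RiemMetric.Conformal.two_mul_vol_eq (hg : g.Conformal (flat β)) (hβ : 0 < β) :
    2 * g.vol = ∫ y in -β..β, ∫ x in (0 : ℝ)..(2 * Real.pi), g.fac x y ^ 2 := by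
  have hk : Continuous fun y => ∫ x in (0 : ℝ)..Real.pi, g.fac x y ^ 2 :=
    intervalIntegral.continuous_parametric_intervalIntegral_of_continuous'
      (f := fun y x => g.fac x y ^ 2) (by
        show Continuous fun p : ℝ × ℝ => g.fac p.2 p.1 ^ 2
        fun_prop) _ _
  have h1 : ∀ y, ∫ x in (0 : ℝ)..(2 * Real.pi), g.fac x y ^ 2 =
      (∫ x in (0 : ℝ)..Real.pi, g.fac x y ^ 2) + ∫ x in (0 : ℝ)..Real.pi, g.fac x (-y) ^ 2 := by
    intro y
    have hc : Continuous fun x => g.fac x y ^ 2 := by fun_prop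
    rw [← intervalIntegral.integral_add_adjacent_intervals (hc.intervalIntegrable _ Real.pi)
      (hc.intervalIntegrable _ _)]
    have := intervalIntegral.integral_comp_add_right (a := 0) (b := Real.pi)
      (f := fun x => g.fac x y ^ 2) Real.pi
    rw [zero_add, ← two_mul] at this
    rw [← this]
    simp only [fac_add_pi]
  have hk' : Continuous fun y => ∫ x in (0 : ℝ)..Real.pi, g.fac x (-y) ^ 2 :=
    hk.comp continuous_neg
  simp only [h1]
  rw [intervalIntegral.integral_add (hk.intervalIntegrable _ _)
    (hk'.intervalIntegrable _ _),
    intervalIntegral.integral_comp_neg (f := fun y => ∫ x in (0 : ℝ)..Real.pi, g.fac x y ^ 2),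
    neg_neg, ← hg.vol_eq_integral hβ]
  ring

/-- Cauchy–Schwarz in the parametrized form 2φ(cw) ≤ φ² + (cw)², integrated over a double
fundamental domain. -/
theorem RiemMetric.Conformal.two_mul_integral_avg_mul_le (hg : g.Conformal (flat β)) (hβ : 0 < β)
    {w : ℝ → ℝ} (hw : Continuous w) (c : ℝ) :
    2 * c * ∫ y in -β..β, g.avg y * w y ≤
      2 * g.vol + c ^ 2 * (2 * Real.pi * ∫ y in -β..β, w y ^ 2) := by
  have hk : Continuous fun y => ∫ x in (0 : ℝ)..(2 * Real.pi), g.fac x y ^ 2 :=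
    intervalIntegral.continuous_parametric_intervalIntegral_of_continuous'
      (f := fun y x => g.fac x y ^ 2) (by
        show Continuous fun p : ℝ × ℝ => g.fac p.2 p.1 ^ 2
        fun_prop) _ _
  have hw2 : Continuous fun y => c ^ 2 * (2 * Real.pi) * w y ^ 2 := by fun_prop
  have hptw : ∀ y, 2 * c * (g.avg y * w y) ≤
      (∫ x in (0 : ℝ)..(2 * Real.pi), g.fac x y ^ 2) + c ^ 2 * (2 * Real.pi) * w y ^ 2 := by
    intro y
    have hc : Continuous fun x => g.fac x y ^ 2 := by fun_prop
    calc 2 * c * (g.avg y * w y) =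
          ∫ x in (0 : ℝ)..(2 * Real.pi), g.fac x y * (2 * c * w y) := by
          rw [intervalIntegral.integral_mul_const, avg]
          ring
      _ ≤ ∫ x in (0 : ℝ)..(2 * Real.pi), (g.fac x y ^ 2 + c ^ 2 * w y ^ 2) := by
          refine intervalIntegral.integral_mono_on (by positivity)
            (Continuous.intervalIntegrable (by fun_prop) _ _)
            (Continuous.intervalIntegrable (by fun_prop) _ _) fun x _ => ?_
          nlinarith [sq_nonneg (g.fac x y - c * w y)]
      _ = _ := by
          rw [intervalIntegral.integral_add (hc.intervalIntegrable _ _) (by simp)]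
          simp
          ring
  rw [hg.two_mul_vol_eq hβ, ← intervalIntegral.integral_const_mul,
    ← mul_assoc, ← intervalIntegral.integral_const_mul (c ^ 2 * (2 * Real.pi)),
    ← intervalIntegral.integral_add (hk.intervalIntegrable _ _) (hw2.intervalIntegrable _ _)]
  exact intervalIntegral.integral_mono_on (by linarith)
    (Continuous.intervalIntegrable (by fun_prop) _ _)
    ((hk.add hw2).intervalIntegrable _ _) fun y _ => hptw y

/-- The isoperimetric inequality furnished by the calibration. -/
theorem RiemMetric.Conformal.lv_mul_lσ_le (hg : g.Conformal (flat β)) (hβ : 0 < β)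
    {τ m : ℝ} (hτ : 0 < τ) (hm0 : 0 ≤ m) (hm : m ≤ 1 / Real.sqrt (1 + τ ^ 2))
    (hL : Real.arsinh τ ≤ β / 2) {w : ℝ → ℝ} (hw : Continuous w) (hper : Function.Periodic w β)
    (hmw : ∀ y, m ≤ w y) (hcosh : ∀ y, |y| ≤ Real.arsinh τ → w y = 1 / Real.cosh y)
    {V : ℝ} (hV : V = Real.pi * ∫ y in -β..β, w y ^ 2) (hV0 : 0 < V)
    (hbal : 0 ≤ τ / Real.sqrt (1 + τ ^ 2) - m * Real.arctan τ) :
    16 * Real.pi * m * (τ / Real.sqrt (1 + τ ^ 2) - m * Real.arctan τ) * (g.lv * g.lσ) ≤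
      V * g.vol := by
  have h1 := hg.le_integral_avg_mul hβ hτ hm0 hm hL hw hper hmw hcosh
  set A := 2 * Real.pi * m * g.lv
  set B := 8 * (τ / Real.sqrt (1 + τ ^ 2) - m * Real.arctan τ) * g.lσ
  have hA : 0 ≤ A := mul_nonneg (by positivity) g.lv_nonneg
  have hB : 0 ≤ B := mul_nonneg (by positivity) g.lσ_nonneg
  -- This value of c maximizes 2c(A + B) - 2Vc².
  have h2 := hg.two_mul_integral_avg_mul_le hβ hw ((A + B) / (2 * V))
  rw [show 2 * Real.pi * ∫ y in -β..β, w y ^ 2 = 2 * V by rw [hV]; ring] at h2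
  have h3 : 2 * ((A + B) / (2 * V)) * (A + B) ≤ 2 * g.vol + ((A + B) / (2 * V)) ^ 2 * (2 * V) :=
    (mul_le_mul_of_nonneg_left h1 (by positivity)).trans h2
  have h4 : (A + B) ^ 2 ≤ 4 * (V * g.vol) := by
    have e1 : 2 * ((A + B) / (2 * V)) * (A + B) = (A + B) ^ 2 / V := by field_simp
    have e2 : ((A + B) / (2 * V)) ^ 2 * (2 * V) = (A + B) ^ 2 / V / 2 := by field_simp
    rw [e1, e2] at h3
    have h5 : (A + B) ^ 2 / V ≤ 4 * g.vol := by linarith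
    rw [div_le_iff₀ hV0] at h5
    linarith
  have h6 : 4 * (A * B) ≤ (A + B) ^ 2 := by nlinarith [sq_nonneg (A - B)]
  have h7 : A * B = 16 * Real.pi * m * (τ / Real.sqrt (1 + τ ^ 2) - m * Real.arctan τ) *
      (g.lv * g.lσ) := by
    simp only [A, B]
    ring
  rw [← h7]
  linarith

end upper

/-! ### Curves joining antipodal points of the sphere, in the Mercator projection -/

/-- The cosine of the spherical distance to the point of coordinates `(x₀, y₀)`. -/
def cosDist (x₀ y₀ x y : ℝ) : ℝ :=
  (Real.cos (x - x₀) + Real.sinh y * Real.sinh y₀) / (Real.cosh y * Real.cosh y₀)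

theorem hasFDerivAt_cosDist (x₀ y₀ s : ℝ) (z : ℂ) :
    HasFDerivAt (fun z : ℂ => cosDist x₀ y₀ z.re (z.im - s))
      ((-Real.sin (z.re - x₀) / (Real.cosh (z.im - s) * Real.cosh y₀)) • Complex.reCLM +
        ((Real.sinh y₀ - Real.sinh (z.im - s) * Real.cos (z.re - x₀)) /
          (Real.cosh (z.im - s) ^ 2 * Real.cosh y₀)) • Complex.imCLM) z := by
  have hre : HasFDerivAt (fun z : ℂ => z.re - x₀) Complex.reCLM z :=
    Complex.reCLM.hasFDerivAt.sub_const x₀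
  have him : HasFDerivAt (fun z : ℂ => z.im - s) Complex.imCLM z :=
    Complex.imCLM.hasFDerivAt.sub_const s
  have hC := (Real.cosh_pos (z.im - s)).ne'
  have hC0 := (Real.cosh_pos y₀).ne'
  have h1 : HasFDerivAt (fun z : ℂ => Real.cos (z.re - x₀)) _ z := hre.cos
  have h2 : HasFDerivAt (fun z : ℂ => Real.sinh (z.im - s)) _ z := him.sinh
  have h3 : HasFDerivAt (fun z : ℂ => Real.cosh (z.im - s)) _ z := him.cosh
  have h := (h1.add (h2.mul_const (Real.sinh y₀))).mul
    ((hasDerivAt_inv (mul_ne_zero hC hC0)).comp_hasFDerivAt z (h3.mul_const (Real.cosh y₀)))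
  refine (h.congr_fderiv ?_).congr_of_eventuallyEq (Filter.Eventually.of_forall fun w => ?_)
  · ext ξ
    simp
    field_simp
    have := Real.cosh_sq (z.im - s)
    linear_combination ξ.im * Real.sinh y₀ * this
  · simp [cosDist, div_eq_mul_inv]

/-- The eikonal equation |∇d| = 1 for the spherical distance d, written for cos d: the left side is
sin² d, and cosh y converts Euclidean into spherical gradients. -/
theorem one_sub_cosDist_sq (x₀ y₀ x y : ℝ) :
    1 - cosDist x₀ y₀ x y ^ 2 = Real.cosh y ^ 2 *
      ((-Real.sin (x - x₀) / (Real.cosh y * Real.cosh y₀)) ^ 2 +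
        ((Real.sinh y₀ - Real.sinh y * Real.cos (x - x₀)) /
          (Real.cosh y ^ 2 * Real.cosh y₀)) ^ 2) := by
  have hC := (Real.cosh_pos y).ne'
  have hC0 := (Real.cosh_pos y₀).ne'
  have h1 := Real.cosh_sq y
  have h2 := Real.cosh_sq y₀
  have h3 := Real.sin_sq (x - x₀)
  rw [cosDist]
  field_simp
  rw [h3, h1, h2]
  ring

/-- As r tends to 1 the function tends to d - π / 2, with d the spherical distance, which is
1-Lipschitz. Taking r < 1 keeps the argument of arcsin away from ±1, where d is not smooth, and only
shrinks the gradient, since r²(1 - c²) ≤ 1 - r²c². -/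
theorem fderiv_arcsin_cosDist_le {x₀ y₀ s r : ℝ} (hr : r ∈ Ioo (0 : ℝ) 1) (z ξ : ℂ) :
    DifferentiableAt ℝ (fun z : ℂ => -Real.arcsin (r * cosDist x₀ y₀ z.re (z.im - s))) z ∧
    fderiv ℝ (fun z : ℂ => -Real.arcsin (r * cosDist x₀ y₀ z.re (z.im - s))) z ξ ≤
      1 / Real.cosh (z.im - s) * ‖ξ‖ := by
  set c := cosDist x₀ y₀ z.re (z.im - s) with hc
  have hC := Real.cosh_pos (z.im - s)
  have hid := one_sub_cosDist_sq x₀ y₀ z.re (z.im - s)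
  rw [← hc] at hid
  have hd := hasFDerivAt_cosDist x₀ y₀ s z
  set a := -Real.sin (z.re - x₀) / (Real.cosh (z.im - s) * Real.cosh y₀)
  set b := (Real.sinh y₀ - Real.sinh (z.im - s) * Real.cos (z.re - x₀)) /
          (Real.cosh (z.im - s) ^ 2 * Real.cosh y₀)
  have hc1 : 0 ≤ 1 - c ^ 2 := by rw [hid]; positivity
  have hr2 : r ^ 2 < 1 := by nlinarith [hr.1, hr.2]
  have hrc : 0 < 1 - (r * c) ^ 2 := by nlinarith [sq_nonneg c]
  have habs := abs_lt.1 ((sq_lt_one_iff_abs_lt_one (r * c)).1 (by linarith))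
  have hD := ((Real.hasDerivAt_arcsin habs.1.ne' habs.2.ne).comp_hasFDerivAt z
    (hd.const_mul r)).neg
  have hD' : HasFDerivAt (fun z : ℂ => -Real.arcsin (r * cosDist x₀ y₀ z.re (z.im - s))) _ z := hD
  refine ⟨hD'.differentiableAt, ?_⟩
  rw [hD'.fderiv]
  have hS := Real.sqrt_pos.2 hrc
  have hS2 := Real.sq_sqrt hrc.le
  simp only [_root_.neg_apply, _root_.smul_apply,
    _root_.add_apply, Complex.reCLM_apply, Complex.imCLM_apply, smul_eq_mul]
  have hn : ‖ξ‖ ^ 2 = ξ.re ^ 2 + ξ.im ^ 2 := by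
    rw [← Complex.normSq_eq_norm_sq, Complex.normSq_apply]; ring
  have hle : -(r * (a * ξ.re + b * ξ.im)) * Real.cosh (z.im - s) ≤
      √(1 - (r * c) ^ 2) * ‖ξ‖ := by
    refine le_of_abs_le (abs_le_of_sq_le_sq ?_ (by positivity))
    have hcs : (a * ξ.re + b * ξ.im) ^ 2 ≤ (a ^ 2 + b ^ 2) * (ξ.re ^ 2 + ξ.im ^ 2) := by
      nlinarith [sq_nonneg (a * ξ.im - b * ξ.re)]
    calc (-(r * (a * ξ.re + b * ξ.im)) * Real.cosh (z.im - s)) ^ 2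
        = r ^ 2 * Real.cosh (z.im - s) ^ 2 * (a * ξ.re + b * ξ.im) ^ 2 := by ring
      _ ≤ r ^ 2 * Real.cosh (z.im - s) ^ 2 * ((a ^ 2 + b ^ 2) * (ξ.re ^ 2 + ξ.im ^ 2)) := by
          gcongr
      _ = r ^ 2 * (1 - c ^ 2) * ‖ξ‖ ^ 2 := by rw [hid, hn]; ring
      _ ≤ (1 - (r * c) ^ 2) * ‖ξ‖ ^ 2 := by
          gcongr
          nlinarith
      _ = _ := by rw [mul_pow _ ‖ξ‖, hS2]
  have e : -(1 / √(1 - (r * c) ^ 2) * (r * (a * ξ.re + b * ξ.im))) =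
      (-(r * (a * ξ.re + b * ξ.im)) * Real.cosh (z.im - s)) /
        (√(1 - (r * c) ^ 2) * Real.cosh (z.im - s)) := by
    field_simp
  rw [e, div_le_iff₀ (by positivity)]
  refine hle.trans_eq ?_
  field_simp

/-- After shifting y by s the endpoints are antipodal on the sphere, so the regularized distance
grows from -arcsin r to arcsin r along the curve. -/
theorem pi_le_integral_of_antipodal {γ : ℝ → ℂ} (hγ : PiecewiseC1 γ) {φ : ℂ → ℝ}
    (hφ : Continuous φ) {s : ℝ} (hle : ∀ z : ℂ, 1 / Real.cosh (z.im - s) ≤ φ z)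
    (hre : (γ 1).re = (γ 0).re + Real.pi) (him : (γ 1).im - s = -((γ 0).im - s)) :
    Real.pi ≤ ∫ t in (0 : ℝ)..1, φ (γ t) * ‖deriv γ t‖ := by
  have key : ∀ r ∈ Ioo (0 : ℝ) 1, 2 * Real.arcsin r ≤ ∫ t in (0 : ℝ)..1, φ (γ t) * ‖deriv γ t‖ := by
    intro r hr
    have h := hγ.sub_le_integral hφ
      (G := fun z : ℂ => -Real.arcsin (r * cosDist (γ 0).re ((γ 0).im - s) z.re (z.im - s)))
      (fun z => (fderiv_arcsin_cosDist_le hr z 0).1)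
      (fun z ξ => (fderiv_arcsin_cosDist_le hr z ξ).2.trans
        (mul_le_mul_of_nonneg_right (hle z) (norm_nonneg ξ)))
    have hC := (Real.cosh_pos ((γ 0).im - s)).ne'
    have hsq := Real.cosh_sq ((γ 0).im - s)
    have h0 : cosDist (γ 0).re ((γ 0).im - s) (γ 0).re ((γ 0).im - s) = 1 := by
      rw [cosDist, sub_self, Real.cos_zero, div_eq_one_iff_eq (by positivity)]
      linear_combination -hsq
    have h1 : cosDist (γ 0).re ((γ 0).im - s) (γ 1).re ((γ 1).im - s) = -1 := by
      rw [cosDist, hre, him, add_sub_cancel_left, Real.cos_pi, Real.sinh_neg, Real.cosh_neg,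
        div_eq_iff (by positivity)]
      linear_combination hsq
    simp only [h0, h1, mul_one, mul_neg, Real.arcsin_neg, neg_neg, sub_neg_eq_add] at h
    linarith
  have hlim : Filter.Tendsto (fun r => 2 * Real.arcsin r) (nhdsWithin 1 (Iio 1))
      (nhds (2 * Real.arcsin 1)) :=
    ((Real.continuous_arcsin.const_mul 2).tendsto 1).mono_left nhdsWithin_le_nhds
  have := le_of_tendsto hlim (Filter.mem_of_superset (Ioo_mem_nhdsLT one_pos) key)
  rw [Real.arcsin_one] at this
  linarith

/-! ### The profile of the extremal metrics -/

/-- The conformal factor of the extremal metric, as a function of `y`: it is `β`-periodic, equal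
to `1 / cosh y` for `|y| ≤ L` and to `1 / cosh L` for `L ≤ |y| ≤ β / 2`. -/
def profile (β L y : ℝ) : ℝ := 1 / Real.cosh (min L ‖(y : AddCircle β)‖)

section profile
variable {β L : ℝ}

@[fun_prop]
theorem continuous_profile : Continuous (profile β L) := by
  have h1 : Continuous fun y : ℝ => ‖(y : AddCircle β)‖ :=
    continuous_norm.comp (AddCircle.continuous_mk' β)
  exact continuous_const.div (Real.continuous_cosh.comp (continuous_const.min h1))
    fun y => (Real.cosh_pos _).ne'

theorem profile_pos (y : ℝ) : 0 < profile β L y := one_div_pos.2 (Real.cosh_pos _)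

theorem profile_periodic : Function.Periodic (profile β L) β := fun y => by
  rw [profile, profile, AddCircle.coe_add_period]

theorem profile_neg (y : ℝ) : profile β L (-y) = profile β L y := by
  rw [profile, profile, AddCircle.coe_neg, norm_neg]

theorem profile_of_abs_le_half (hβ : 0 < β) {y : ℝ} (hy : |y| ≤ β / 2) :
    profile β L y = 1 / Real.cosh (min L |y|) := by
  rw [profile, (AddCircle.norm_coe_eq_abs_iff β hβ.ne').2 (by rwa [abs_of_pos hβ])]

theorem profile_of_abs_le (hβ : 0 < β) (hL : L ≤ β / 2) {y : ℝ} (hy : |y| ≤ L) :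
    profile β L y = 1 / Real.cosh y := by
  rw [profile_of_abs_le_half hβ (hy.trans hL), min_eq_right hy, Real.cosh_abs]

theorem profile_of_le_abs (hβ : 0 < β) {y : ℝ} (hy : L ≤ |y|) (hy' : |y| ≤ β / 2) :
    profile β L y = 1 / Real.cosh L := by
  rw [profile_of_abs_le_half hβ hy', min_eq_left hy]

theorem one_div_cosh_le_profile (hL : 0 ≤ L) (y : ℝ) : 1 / Real.cosh L ≤ profile β L y := by
  refine one_div_le_one_div_of_le (Real.cosh_pos _) (Real.cosh_le_cosh.2 ?_)
  rw [abs_of_nonneg (le_min hL (norm_nonneg _)), abs_of_nonneg hL]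
  exact min_le_left _ _

/-- The distance from y to βℤ is at most |y - kβ|. The extremal metric thus dominates the round
metric centred on every line y = kβ, whatever the truncation L. -/
theorem one_div_cosh_sub_le_profile (hL : 0 ≤ L) (y : ℝ) (k : ℤ) :
    1 / Real.cosh (y - k * β) ≤ profile β L y := by
  rw [← profile_periodic.sub_int_mul_eq k (x := y)]
  refine one_div_le_one_div_of_le (Real.cosh_pos _) (Real.cosh_le_cosh.2 ?_)
  rw [abs_of_nonneg (le_min hL (norm_nonneg _))]
  refine (min_le_right _ _).trans ?_
  rw [← Real.norm_eq_abs]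
  exact QuotientAddGroup.norm_mk_le_norm

/-- The arc length along the vertical lines for the extremal metric. -/
def arcLen (β L y : ℝ) : ℝ := ∫ t in (0 : ℝ)..y, profile β L t

theorem hasDerivAt_arcLen (y : ℝ) : HasDerivAt (arcLen β L) (profile β L y) y :=
  continuous_profile.integral_hasStrictDerivAt 0 y |>.hasDerivAt

theorem arcLen_zero : arcLen β L 0 = 0 := intervalIntegral.integral_same

theorem arcLen_neg (y : ℝ) : arcLen β L (-y) = -arcLen β L y := by
  have := intervalIntegral.integral_comp_neg (a := 0) (b := y) (f := profile β L)
  simp only [profile_neg, neg_zero] at this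
  rw [arcLen, arcLen, this, intervalIntegral.integral_symm]

theorem arcLen_add_period (y : ℝ) : arcLen β L (y + β) = arcLen β L y + 2 * arcLen β L (β / 2) := by
  have h1 : arcLen β L (y + β) - arcLen β L y = ∫ t in y..y + β, profile β L t :=
    intervalIntegral.integral_interval_sub_left (continuous_profile.intervalIntegrable _ _)
      (continuous_profile.intervalIntegrable _ _)
  have h2 : arcLen β L (β / 2) - arcLen β L (-(β / 2)) =
      ∫ t in -(β / 2)..(β / 2), profile β L t :=
    intervalIntegral.integral_interval_sub_left (continuous_profile.intervalIntegrable _ _)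
      (continuous_profile.intervalIntegrable _ _)
  have h3 := (profile_periodic (β := β) (L := L)).intervalIntegral_add_eq y (-(β / 2))
  rw [show -(β / 2) + β = β / 2 by ring] at h3
  rw [arcLen_neg] at h2
  linarith

theorem arcLen_add_two_mul (y : ℝ) :
    arcLen β L (y + 2 * β) = arcLen β L y + 4 * arcLen β L (β / 2) := by
  rw [two_mul, ← add_assoc, arcLen_add_period, arcLen_add_period]
  ring

/-- On the spherical part the arc length is the latitude, that is the Gudermannian function, whose
derivative is 1 / cosh. -/
theorem arcLen_of_abs_le (hβ : 0 < β) (hL : L ≤ β / 2) {y : ℝ} (hy : |y| ≤ L) :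
    arcLen β L y = Real.arctan (Real.sinh y) := by
  have hd : ∀ t : ℝ, HasDerivAt (fun t => Real.arctan (Real.sinh t)) (1 / Real.cosh t) t := by
    intro t
    refine ((Real.hasDerivAt_arctan _).comp t (Real.hasDerivAt_sinh t)).congr_deriv ?_
    have := (Real.cosh_pos t).ne'
    rw [add_comm, ← Real.cosh_sq]
    field_simp
  have hc : Continuous fun t : ℝ => 1 / Real.cosh t :=
    continuous_const.div Real.continuous_cosh fun y => (Real.cosh_pos _).ne'
  have h := intervalIntegral.integral_eq_sub_of_hasDerivAt (a := 0) (b := y) (fun t _ => hd t)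
    (hc.intervalIntegrable _ _)
  rw [Real.sinh_zero, Real.arctan_zero, sub_zero] at h
  rw [← h, arcLen]
  refine intervalIntegral.integral_congr fun t ht => profile_of_abs_le hβ hL (le_trans ?_ hy)
  simpa using abs_sub_left_of_mem_uIcc ht

theorem arcLen_half (hβ : 0 < β) (hL0 : 0 ≤ L) (hL : L ≤ β / 2) :
    arcLen β L (β / 2) = Real.arctan (Real.sinh L) + (β / 2 - L) * (1 / Real.cosh L) := by
  rw [← arcLen_of_abs_le hβ hL (abs_of_nonneg hL0).le, arcLen,
    ← intervalIntegral.integral_add_adjacent_intervals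
    (continuous_profile.intervalIntegrable 0 L) (continuous_profile.intervalIntegrable _ _)]
  have : ∫ t in L..β / 2, profile β L t = ∫ t in L..β / 2, 1 / Real.cosh L := by
    refine intervalIntegral.integral_congr fun t ht => ?_
    rw [uIcc_of_le hL] at ht
    have ht0 : |t| = t := abs_of_nonneg (hL0.trans ht.1)
    exact profile_of_le_abs hβ (by rw [ht0]; exact ht.1) (by rw [ht0]; exact ht.2)
  rw [this, intervalIntegral.integral_const, arcLen, smul_eq_mul]

theorem integral_profile_sq (hβ : 0 < β) (hL0 : 0 ≤ L) (hL : L ≤ β / 2) :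
    ∫ y in -β..β, profile β L y ^ 2 =
      4 * (Real.tanh L + (β / 2 - L) * (1 / Real.cosh L) ^ 2) := by
  have hper : Function.Periodic (fun y => profile β L y ^ 2) β := fun y => by
    simp only [profile_periodic y]
  have hc : Continuous fun y => profile β L y ^ 2 := by fun_prop
  have hi := fun a b => hc.intervalIntegrable (μ := MeasureTheory.volume) a b
  have h1 := hper.intervalIntegral_add_eq (-β) (-(β / 2))
  have h2 := hper.intervalIntegral_add_eq 0 (-(β / 2))
  rw [show -(β / 2) + β = β / 2 by ring] at h1 h2
  rw [show -β + β = 0 by ring] at h1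
  rw [zero_add] at h2
  have h3 : ∫ y in -(β / 2)..0, profile β L y ^ 2 = ∫ y in 0..(β / 2), profile β L y ^ 2 := by
    have := intervalIntegral.integral_comp_neg (a := 0) (b := β / 2)
      (f := fun y => profile β L y ^ 2)
    simp only [profile_neg, neg_zero] at this
    exact this.symm
  have h4 : ∫ y in (0 : ℝ)..L, profile β L y ^ 2 = Real.tanh L := by
    have hd : ∀ t : ℝ, HasDerivAt Real.tanh ((1 / Real.cosh t) ^ 2) t := by
      intro t
      have h := (Real.hasDerivAt_sinh t).div (Real.hasDerivAt_cosh t) (Real.cosh_pos t).ne'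
      refine (h.congr_deriv ?_).congr_of_eventuallyEq
        (Filter.Eventually.of_forall fun x => Real.tanh_eq_sinh_div_cosh x)
      rw [div_pow, one_pow]
      congr 1
      have := Real.cosh_sq t
      linear_combination this
    have hc' : Continuous fun t : ℝ => (1 / Real.cosh t) ^ 2 :=
      (continuous_const.div Real.continuous_cosh fun y => (Real.cosh_pos _).ne').pow 2
    have h := intervalIntegral.integral_eq_sub_of_hasDerivAt (a := 0) (b := L) (fun t _ => hd t)
      (hc'.intervalIntegrable _ _)
    rw [Real.tanh_zero, sub_zero] at h
    rw [← h]
    refine intervalIntegral.integral_congr fun t ht => ?_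
    rw [uIcc_of_le hL0] at ht
    simp only [profile_of_abs_le hβ hL (abs_le.2 ⟨by linarith [ht.1], ht.2⟩)]
  have h5 : ∫ y in L..(β / 2), profile β L y ^ 2 = (β / 2 - L) * (1 / Real.cosh L) ^ 2 := by
    have : ∫ t in L..β / 2, profile β L t ^ 2 = ∫ t in L..β / 2, (1 / Real.cosh L) ^ 2 := by
      refine intervalIntegral.integral_congr fun t ht => ?_
      rw [uIcc_of_le hL] at ht
      have ht0 : |t| = t := abs_of_nonneg (hL0.trans ht.1)
      have hp : profile β L t = 1 / Real.cosh L :=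
        profile_of_le_abs hβ (by rw [ht0]; exact ht.1) (by rw [ht0]; exact ht.2)
      simp only [hp]
    rw [this, intervalIntegral.integral_const, smul_eq_mul]
  rw [← intervalIntegral.integral_add_adjacent_intervals (hi _ 0) (hi _ _), h1, h2,
    ← intervalIntegral.integral_add_adjacent_intervals (hi _ 0) (hi _ _), h3,
    ← intervalIntegral.integral_add_adjacent_intervals (hi _ L) (hi _ _), h4, h5]
  ring

end profile

/-! ### The extremal metrics -/

/-- The metric on the Klein bottle with conformal factor `profile β L`. -/
def extremal (β L : ℝ) : RiemMetric β where
  form z := profile β L z.im ^ 2 • innerₗ ℂ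
  symm z ξ η := by
    simp only [LinearMap.smul_apply, innerₗ_apply_apply, real_inner_comm]
  pos z ξ hξ := by
    simp only [LinearMap.smul_apply, innerₗ_apply_apply, smul_eq_mul]
    exact mul_pos (pow_pos (profile_pos _) 2) (real_inner_self_pos.2 hξ)
  cont ξ η := by
    simp only [LinearMap.smul_apply, innerₗ_apply_apply, smul_eq_mul]
    fun_prop
  glide_inv z ξ η := by
    rw [glide_im, profile_neg]
    simp [Complex.inner]
  vert_inv z ξ η := by
    have : profile β L ((vert β z).im) = profile β L z.im := by
      rw [vert_im, two_mul, ← add_assoc, profile_periodic, profile_periodic]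
    rw [this]

section extremal
variable {β L : ℝ}

theorem extremal_form (z ξ η : ℂ) :
    (extremal β L).form z ξ η = profile β L z.im ^ 2 * inner ℝ ξ η := rfl

theorem extremal_conformal : (extremal β L).Conformal (flat β) :=
  ⟨fun z => profile β L z.im ^ 2, fun _ => pow_pos (profile_pos _) 2, fun _ _ _ => rfl⟩

theorem extremal_factor (z : ℂ) : (extremal β L).factor z = profile β L z.im := by
  rw [RiemMetric.factor, extremal_form]
  simp [Real.sqrt_sq (profile_pos _).le]

theorem extremal_length (γ : ℝ → ℂ) :
    (extremal β L).length γ = ∫ s in (0 : ℝ)..1, profile β L (γ s).im * ‖deriv γ s‖ := by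
  rw [extremal_conformal.length_eq]
  simp only [extremal_factor]

theorem extremal_vol (hβ : 0 < β) :
    (extremal β L).vol = Real.pi * ∫ y in -β..β, profile β L y ^ 2 := by
  rw [extremal_conformal.vol_eq_integral hβ, ← intervalIntegral.integral_const_mul]
  simp [RiemMetric.fac, extremal_factor]

/-- The vertical arc length, as a function on the plane, has gradient of norm 1 for the extremal
metric. -/
theorem abs_arcLen_sub_le_length {γ : ℝ → ℂ} (hγ : PiecewiseC1 γ) :
    |arcLen β L (γ 1).im - arcLen β L (γ 0).im| ≤ (extremal β L).length γ := by
  have hd : ∀ z : ℂ, HasFDerivAt (fun z : ℂ => arcLen β L z.im)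
      (profile β L z.im • Complex.imCLM) z := fun z =>
    (hasDerivAt_arcLen z.im).comp_hasFDerivAt z Complex.imCLM.hasFDerivAt
  have hφ : Continuous fun z : ℂ => profile β L z.im := by fun_prop
  rw [extremal_length, abs_le']
  constructor
  · refine hγ.sub_le_integral (G := fun z : ℂ => arcLen β L z.im) hφ
      (fun z => (hd z).differentiableAt) fun z ξ => ?_
    rw [(hd z).fderiv]
    exact mul_le_mul_of_nonneg_left ((le_abs_self _).trans (Complex.abs_im_le_norm ξ))
      (profile_pos _).le
  · have := hγ.sub_le_integral (G := fun z : ℂ => -arcLen β L z.im) hφ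
      (fun z => (hd z).neg.differentiableAt) fun z ξ => by
        rw [(hd z).fun_neg.fderiv, _root_.neg_apply, _root_.smul_apply, smul_eq_mul,
          ← mul_neg]
        exact mul_le_mul_of_nonneg_left ((neg_le_abs _).trans (Complex.abs_im_le_norm ξ))
          (profile_pos _).le
    linarith

/-- A vertical period 2β consists of four copies of [0, β / 2] up to reflection; a loop of the class
crosses such a period, upwards or downwards. -/
theorem le_extremal_lv (hβ : 0 < β) : 4 * arcLen β L (β / 2) ≤ (extremal β L).lv := by
  refine (extremal β L).le_minLength (δ := fun s : ℝ => (s : ℂ) * (2 * Complex.I * (β : ℂ)))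
    (Complex.ofRealCLM.contDiff.mul contDiff_const) (by
      rw [proj_eq_iff]
      exact ⟨0, 1, by simp, by simp⟩) fun γ hγ hh => ?_
  have h1 := FreelyHomotopic.of_vertLoop hβ hγ.continuousOn hh
  refine le_trans ?_ (abs_arcLen_sub_le_length hγ)
  rcases abs_eq (by positivity) |>.1 h1 with h | h
  · rw [show (γ 1).im = (γ 0).im + 2 * β by linarith, arcLen_add_two_mul, add_sub_cancel_left]
    exact le_abs_self _
  · rw [show (γ 0).im = (γ 1).im + 2 * β by linarith, arcLen_add_two_mul]
    refine le_trans (le_of_eq ?_) (neg_le_abs _)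
    ring

/-- The map t ^ k σ is a glide along the line y = kβ, hence the antipodal map of the sphere centred
on that line. -/
theorem pi_le_extremal_length (hL : 0 ≤ L) {γ : ℝ → ℂ} (hγ : PiecewiseC1 γ) {k : ℤ}
    (h : ActsAs β 1 k (γ 0) (γ 1)) : Real.pi ≤ (extremal β L).length γ := by
  rw [extremal_length]
  refine pi_le_integral_of_antipodal (φ := fun z => profile β L z.im) hγ (by fun_prop)
    (s := k * β) (fun z => one_div_cosh_sub_le_profile hL z.im k) ?_ ?_
  · rw [h.1]; simp
  · rw [h.2]; simp; ring

theorem pi_le_extremal_lσ (hβ : 0 < β) (hL : 0 ≤ L) : Real.pi ≤ (extremal β L).lσ := by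
  refine le_min ?_ ?_
  · refine (extremal β L).le_minLength (δ := fun s : ℝ => (s : ℂ) * (Real.pi : ℂ))
      (Complex.ofRealCLM.contDiff.mul contDiff_const) (by
        rw [proj_eq_iff]
        exact ⟨1, 0, by simp, by simp⟩) fun γ hγ hh => ?_
    obtain ⟨k, hk⟩ := FreelyHomotopic.of_glideLoop hβ hγ.continuousOn hh
    exact pi_le_extremal_length hL hγ hk
  · refine (extremal β L).le_minLength
      (δ := fun s : ℝ => Complex.I * (β : ℂ) + (s : ℂ) * (Real.pi : ℂ))
      (contDiff_const.add (Complex.ofRealCLM.contDiff.mul contDiff_const)) (by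
        rw [proj_eq_iff]
        exact ⟨1, 1, by simp, by simp; ring⟩) fun γ hγ hh => ?_
    obtain ⟨k, hk⟩ := FreelyHomotopic.of_glideLoop' hβ hγ.continuousOn hh
    exact pi_le_extremal_length hL hγ hk

end extremal

/-! ### The extremal metrics are spherical or flat-spherical -/

section model
variable {β L : ℝ}

theorem continuous_arcLen : Continuous (arcLen β L) :=
  continuous_iff_continuousAt.2 fun y => (hasDerivAt_arcLen y).continuousAt

theorem strictMono_arcLen : StrictMono (arcLen β L) :=
  strictMono_of_deriv_pos fun y => by
    rw [(hasDerivAt_arcLen y).deriv]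
    exact profile_pos y

theorem mul_le_arcLen (hL : 0 ≤ L) {y : ℝ} (hy : 0 ≤ y) : 1 / Real.cosh L * y ≤ arcLen β L y := by
  calc 1 / Real.cosh L * y = ∫ _ in (0 : ℝ)..y, 1 / Real.cosh L := by simp; ring
    _ ≤ _ := intervalIntegral.integral_mono_on hy (by simp)
      (continuous_profile.intervalIntegrable _ _) fun t _ => one_div_cosh_le_profile hL t

theorem surjective_arcLen (hL : 0 ≤ L) : Function.Surjective (arcLen β L) := by
  have htop : Filter.Tendsto (arcLen β L) Filter.atTop Filter.atTop :=
    Filter.tendsto_atTop_mono' _ ((Filter.eventually_ge_atTop 0).mono fun y hy =>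
      mul_le_arcLen hL hy) (Filter.tendsto_id.const_mul_atTop (one_div_pos.2 (Real.cosh_pos L)))
  refine continuous_arcLen.surjective htop ?_
  have : arcLen β L = fun y => -arcLen β L (-y) := funext fun y => by rw [arcLen_neg, neg_neg]
  rw [this]
  exact Filter.tendsto_neg_atTop_atBot.comp (htop.comp Filter.tendsto_neg_atBot_atTop)

/-- The arc length along the vertical lines, as a homeomorphism. -/
def arcLenHomeo (β : ℝ) {L : ℝ} (hL : 0 ≤ L) : ℝ ≃ₜ ℝ :=
  (strictMono_arcLen.orderIsoOfSurjective (arcLen β L) (surjective_arcLen hL)).toHomeomorph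

theorem arcLenHomeo_apply (hL : 0 ≤ L) (y : ℝ) : arcLenHomeo β hL y = arcLen β L y := rfl

theorem contDiff_arcLen : ContDiff ℝ 1 (arcLen β L) := by
  rw [contDiff_one_iff_deriv]
  refine ⟨fun y => (hasDerivAt_arcLen y).differentiableAt, ?_⟩
  rw [show deriv (arcLen β L) = profile β L from funext fun y => (hasDerivAt_arcLen y).deriv]
  exact continuous_profile

theorem contDiff_arcLenHomeo_symm (hL : 0 ≤ L) : ContDiff ℝ 1 (arcLenHomeo β hL).symm :=
  (arcLenHomeo β hL).contDiff_symm_deriv (fun y => (profile_pos y).ne')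
    (fun y => hasDerivAt_arcLen y) contDiff_arcLen

theorem abs_arcLen (y : ℝ) : |arcLen β L y| = arcLen β L |y| := by
  rcases le_total 0 y with h | h
  · rw [abs_of_nonneg h, abs_of_nonneg (arcLen_zero (β := β) (L := L) ▸
      strictMono_arcLen.monotone h)]
  · rw [abs_of_nonpos h, arcLen_neg, abs_of_nonpos (arcLen_zero (β := β) (L := L) ▸
      strictMono_arcLen.monotone h)]

theorem arcLen_add_two_mul_int (y : ℝ) (k : ℤ) :
    arcLen β L (y + 2 * β * k) = arcLen β L y + 2 * (2 * arcLen β L (β / 2)) * k := by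
  induction k using Int.induction_on with
  | zero => simp
  | succ i ih =>
    have h := arcLen_add_two_mul (β := β) (L := L) (y + 2 * β * (i : ℤ))
    rw [ih] at h
    rw [show y + 2 * β * ((i + 1 : ℤ) : ℝ) = y + 2 * β * (i : ℤ) + 2 * β by push_cast; ring, h]
    push_cast
    ring
  | pred i ih =>
    have h := arcLen_add_two_mul (β := β) (L := L) (y + 2 * β * ((-i - 1 : ℤ) : ℝ))
    rw [show y + 2 * β * ((-i - 1 : ℤ) : ℝ) + 2 * β = y + 2 * β * ((-i : ℤ) : ℝ) by
      push_cast; ring, ih] at h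
    push_cast at h ⊢
    linarith

theorem arcLen_deck (y : ℝ) (n k : ℤ) :
    arcLen β L ((-1 : ℝ) ^ n * y + 2 * β * k) =
      (-1 : ℝ) ^ n * arcLen β L y + 2 * (2 * arcLen β L (β / 2)) * k := by
  rw [arcLen_add_two_mul_int]
  rcases Int.even_or_odd n with h | h
  · simp [h.neg_one_zpow]
  · simp [h.neg_one_zpow, arcLen_neg]

/-- The change of coordinates `u + i v = x + i v(y)`, where `v` is the arc length. -/
def coordChange (β : ℝ) {L : ℝ} (hL : 0 ≤ L) : ℂ ≃ₜ ℂ where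
  toFun z := z.re + (arcLenHomeo β hL z.im : ℝ) * Complex.I
  invFun z := z.re + ((arcLenHomeo β hL).symm z.im : ℝ) * Complex.I
  left_inv z := by apply Complex.ext <;> simp
  right_inv z := by apply Complex.ext <;> simp
  continuous_toFun := by fun_prop
  continuous_invFun := by fun_prop

theorem coordChange_re (hL : 0 ≤ L) (z : ℂ) : (coordChange β hL z).re = z.re := by
  simp [coordChange]

theorem coordChange_im (hL : 0 ≤ L) (z : ℂ) : (coordChange β hL z).im = arcLen β L z.im := by
  simp [coordChange, arcLenHomeo_apply]

theorem contDiff_re_add_comp_im_mul_I {e : ℝ → ℝ} (he : ContDiff ℝ 1 e) :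
    ContDiff ℝ 1 fun z : ℂ => (z.re : ℂ) + (e z.im : ℝ) * Complex.I :=
  (Complex.ofRealCLM.contDiff.comp Complex.reCLM.contDiff).add
    ((Complex.ofRealCLM.contDiff.comp (he.comp Complex.imCLM.contDiff)).mul contDiff_const)

theorem fderiv_coordChange (hL : 0 ≤ L) (z ξ : ℂ) :
    (fderiv ℝ (coordChange β hL) z ξ).re = ξ.re ∧
      (fderiv ℝ (coordChange β hL) z ξ).im = profile β L z.im * ξ.im := by
  have h1 : HasFDerivAt (fun z : ℂ => (z.re : ℂ)) (Complex.ofRealCLM.comp Complex.reCLM) z :=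
    (Complex.ofRealCLM.comp Complex.reCLM).hasFDerivAt
  have h2 : HasFDerivAt (fun z : ℂ => ((arcLen β L z.im : ℝ) : ℂ))
      (Complex.ofRealCLM.comp (profile β L z.im • Complex.imCLM)) z :=
    Complex.ofRealCLM.hasFDerivAt.comp z
      ((hasDerivAt_arcLen z.im).comp_hasFDerivAt z Complex.imCLM.hasFDerivAt)
  have h : HasFDerivAt (coordChange β hL) _ z := h1.add (h2.mul_const Complex.I)
  rw [h.fderiv]
  simp

/-- The arc length is odd and increases by 4b over a period 2β, where b is its value at β / 2, so it
intertwines the two deck groups. -/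
theorem proj_coordChange_eq_iff (hL : 0 ≤ L) (z w : ℂ) :
    proj β z = proj β w ↔
      proj (2 * arcLen β L (β / 2)) (coordChange β hL z) =
        proj (2 * arcLen β L (β / 2)) (coordChange β hL w) := by
  simp only [proj_eq_iff, ActsAs, coordChange_re, coordChange_im, ← arcLen_deck,
    strictMono_arcLen.injective.eq_iff]

theorem profile_symm_add_period (hL : 0 ≤ L) (v : ℝ) :
    profile β L ((arcLenHomeo β hL).symm (v + 2 * arcLen β L (β / 2))) =
      profile β L ((arcLenHomeo β hL).symm v) := by
  have : (arcLenHomeo β hL).symm (v + 2 * arcLen β L (β / 2)) =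
      (arcLenHomeo β hL).symm v + β := by
    rw [Homeomorph.symm_apply_eq, arcLenHomeo_apply, arcLen_add_period,
      ← arcLenHomeo_apply hL ((arcLenHomeo β hL).symm v), Homeomorph.apply_symm_apply]
  rw [this, profile_periodic]

theorem profile_symm_neg (hL : 0 ≤ L) (v : ℝ) :
    profile β L ((arcLenHomeo β hL).symm (-v)) = profile β L ((arcLenHomeo β hL).symm v) := by
  have : (arcLenHomeo β hL).symm (-v) = -(arcLenHomeo β hL).symm v := by
    rw [Homeomorph.symm_apply_eq, arcLenHomeo_apply, arcLen_neg, ← arcLenHomeo_apply hL,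
      Homeomorph.apply_symm_apply]
  rw [this, profile_neg]

/-- The extremal metric in the coordinates `(u, v)`. -/
def model (β : ℝ) {L : ℝ} (hL : 0 ≤ L) : RiemMetric (2 * arcLen β L (β / 2)) where
  form z := LinearMap.mk₂ ℝ (fun ξ η => profile β L ((arcLenHomeo β hL).symm z.im) ^ 2 *
      (ξ.re * η.re) + ξ.im * η.im)
    (fun _ _ _ => by simp only [Complex.add_re, Complex.add_im]; ring)
    (fun _ _ _ => by simp only [Complex.smul_re, Complex.smul_im, smul_eq_mul]; ring)
    (fun _ _ _ => by simp only [Complex.add_re, Complex.add_im]; ring)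
    (fun _ _ _ => by simp only [Complex.smul_re, Complex.smul_im, smul_eq_mul]; ring)
  symm z ξ η := by
    simp only [LinearMap.mk₂_apply]
    ring
  pos z ξ hξ := by
    simp only [LinearMap.mk₂_apply]
    have hp := profile_pos (β := β) (L := L) ((arcLenHomeo β hL).symm z.im)
    by_cases h : ξ.re = 0
    · have him : ξ.im ≠ 0 := fun h' => hξ (Complex.ext h h')
      have := mul_self_pos.2 him
      rw [h]
      linarith
    · have := mul_pos (pow_pos hp 2) (mul_self_pos.2 h)
      linarith [mul_self_nonneg ξ.im]
  cont ξ η := by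
    simp only [LinearMap.mk₂_apply]
    fun_prop
  glide_inv z ξ η := by
    simp only [LinearMap.mk₂_apply, glide_im, profile_symm_neg, Complex.conj_re, Complex.conj_im]
    ring
  vert_inv z ξ η := by
    have h := (profile_symm_add_period (β := β) hL (z.im + 2 * arcLen β L (β / 2))).trans
      (profile_symm_add_period hL z.im)
    rw [add_assoc, ← two_mul] at h
    simp only [LinearMap.mk₂_apply, vert_im, h]

/-- Since dv = w dy, the metric w²(dx² + dy²) becomes w² du² + dv². -/
theorem extremal_isometric_model (hL : 0 ≤ L) : (extremal β L).Isometric (model β hL) := by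
  refine ⟨coordChange β hL, contDiff_re_add_comp_im_mul_I contDiff_arcLen,
    contDiff_re_add_comp_im_mul_I (contDiff_arcLenHomeo_symm hL), proj_coordChange_eq_iff hL,
    fun z ξ η => ?_⟩
  have hs : (arcLenHomeo β hL).symm (arcLen β L z.im) = z.im :=
    (arcLenHomeo β hL).symm_apply_apply z.im
  rw [extremal_form]
  simp only [model, LinearMap.mk₂_apply, fderiv_coordChange, coordChange_im, hs, Complex.inner]
  simp
  ring

/-- The region |y| ≤ L corresponds to |v| ≤ ω by monotonicity of the arc length, and there v =
arctan(sinh y), so that cos v = 1 / cosh y. -/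
theorem model_isFlatSphericalModel (hβ : 0 < β) (hL : 0 ≤ L) (hLβ : L ≤ β / 2) :
    IsFlatSphericalModel (arcLen β L (β / 2)) (Real.arctan (Real.sinh L)) (model β hL) := by
  have hω := arcLen_of_abs_le hβ hLβ (abs_of_nonneg hL).le
  have habs : ∀ v : ℝ, |v| = arcLen β L |(arcLenHomeo β hL).symm v| := fun v => by
    rw [← abs_arcLen, ← arcLenHomeo_apply hL, Homeomorph.apply_symm_apply]
  refine ⟨fun v => profile β L ((arcLenHomeo β hL).symm v), profile_symm_add_period hL,
    fun v hv => ?_, fun v hv hv' => ?_, fun z ξ η => rfl⟩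
  · rw [habs, ← hω, strictMono_arcLen.le_iff_le] at hv
    have hv2 := arcLen_of_abs_le hβ hLβ hv
    rw [← arcLenHomeo_apply hL, Homeomorph.apply_symm_apply] at hv2
    dsimp only
    rw [profile_of_abs_le hβ hLβ hv]
    conv_rhs => rw [hv2]
    rw [Real.cos_arctan, add_comm, ← Real.cosh_sq, Real.sqrt_sq (Real.cosh_pos _).le]
  · rw [habs, ← hω, strictMono_arcLen.le_iff_le] at hv
    rw [habs, strictMono_arcLen.le_iff_le] at hv'
    dsimp only
    rw [profile_of_le_abs hβ hv hv', Real.cos_arctan, add_comm, ← Real.cosh_sq,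
      Real.sqrt_sq (Real.cosh_pos _).le]

theorem extremal_isFlatSpherical (hβ : 0 < β) (hL : 0 ≤ L) (hLβ : L ≤ β / 2) :
    (extremal β L).IsFlatSpherical (arcLen β L (β / 2)) (Real.arctan (Real.sinh L)) :=
  ⟨model β hL, model_isFlatSphericalModel hβ hL hLβ, extremal_isometric_model hL⟩

theorem RiemMetric.IsFlatSpherical.isSpherical {g : RiemMetric β} {b : ℝ}
    (h : g.IsFlatSpherical b b) : g.IsSpherical b := by
  obtain ⟨h, ⟨f, h1, h2, -, h3⟩, h4⟩ := h
  exact ⟨h, ⟨f, h1, h2, h3⟩, h4⟩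

end model

/-! ### Trigonometric facts -/

/-- Two expressions of the inverse Gudermannian function, the Mercator height of latitude x. -/
theorem log_tan_eq_arsinh_tan {x : ℝ} (hx : x ∈ Ioo 0 (Real.pi / 2)) :
    Real.log (Real.tan (Real.pi / 4 + x / 2)) = Real.arsinh (Real.tan x) := by
  have hc : 0 < Real.cos x := Real.cos_pos_of_mem_Ioo ⟨by linarith [hx.1, hx.2], hx.2⟩
  have hh : 0 < Real.cos (Real.pi / 4 + x / 2) :=
    Real.cos_pos_of_mem_Ioo ⟨by linarith [hx.1, Real.pi_pos], by linarith [hx.2]⟩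
  have hs : √(1 + Real.tan x ^ 2) = 1 / Real.cos x := by
    have h := Real.inv_sqrt_one_add_tan_sq hc
    rw [← h, one_div, inv_inv]
  rw [Real.arsinh, hs]
  congr 1
  set t := x / 2 with ht
  have hx2 : x = 2 * t := by rw [ht]; ring
  rw [Real.tan_eq_sin_div_cos, Real.tan_eq_sin_div_cos, ← add_div, div_eq_div_iff hh.ne' hc.ne',
    Real.sin_add, Real.cos_add, Real.sin_pi_div_four, Real.cos_pi_div_four, hx2, Real.sin_two_mul,
    Real.cos_two_mul']
  have := Real.sin_sq_add_cos_sq t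
  linear_combination (√2 / 2 * (Real.cos t - Real.sin t)) * this

/-- Slopes of secants through the origin of a strictly convex function vanishing there. It makes b₀
the threshold between tan x ≤ 2x and tan x ≥ 2x. -/
theorem tan_div_self_strictMonoOn :
    StrictMonoOn (fun x => Real.tan x / x) (Ioo 0 (Real.pi / 2)) := by
  have hcos : ∀ x ∈ Ico 0 (Real.pi / 2), 0 < Real.cos x := fun x hx =>
    Real.cos_pos_of_mem_Ioo ⟨by linarith [hx.1, Real.pi_pos], hx.2⟩
  have hconv : StrictConvexOn ℝ (Ico 0 (Real.pi / 2)) Real.tan := by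
    refine StrictMonoOn.strictConvexOn_of_deriv (convex_Ico _ _) ?_ ?_
    · intro x hx
      exact (Real.continuousAt_tan.2 (hcos x hx).ne').continuousWithinAt
    · rw [interior_Ico]
      intro x hx y hy hxy
      have hx' := hcos x (Ioo_subset_Ico_self hx)
      have hy' := hcos y (Ioo_subset_Ico_self hy)
      rw [Real.deriv_tan, Real.deriv_tan]
      have : Real.cos y < Real.cos x :=
        Real.cos_lt_cos_of_nonneg_of_le_pi_div_two hx.1.le hy.2.le hxy
      exact one_div_lt_one_div_of_lt (by positivity) (by gcongr)
  intro x hx y hy hxy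
  have h := hconv.secant_strict_mono (a := 0) ⟨le_rfl, by positivity⟩ (Ioo_subset_Ico_self hx)
    (Ioo_subset_Ico_self hy) hx.1.ne' hy.1.ne' hxy
  simpa using h

section thresholds
variable {b₀ : ℝ}

theorem tan_le_two_mul_of_le (hb₀ : b₀ ∈ Ioo 0 (Real.pi / 2)) (htan : Real.tan b₀ = 2 * b₀)
    {b : ℝ} (hb : b ∈ Ioc 0 b₀) : Real.tan b ≤ 2 * b := by
  have h := tan_div_self_strictMonoOn.monotoneOn ⟨hb.1, hb.2.trans_lt hb₀.2⟩ hb₀ hb.2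
  simp only [htan] at h
  rwa [mul_div_cancel_right₀ _ hb₀.1.ne', div_le_iff₀ hb.1] at h

theorem two_mul_lt_tan_of_lt (hb₀ : b₀ ∈ Ioo 0 (Real.pi / 2)) (htan : Real.tan b₀ = 2 * b₀)
    {x : ℝ} (hx : x ∈ Ioo b₀ (Real.pi / 2)) : 2 * x < Real.tan x := by
  have hx0 : 0 < x := hb₀.1.trans hx.1
  have h := tan_div_self_strictMonoOn hb₀ ⟨hx0, hx.2⟩ hx.1
  simp only [htan] at h
  rwa [mul_div_cancel_right₀ _ hb₀.1.ne', lt_div_iff₀ hx0] at h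

theorem two_mul_le_tan_of_le (hb₀ : b₀ ∈ Ioo 0 (Real.pi / 2)) (htan : Real.tan b₀ = 2 * b₀)
    {x : ℝ} (hx : x ∈ Ico b₀ (Real.pi / 2)) : 2 * x ≤ Real.tan x := by
  rcases hx.1.eq_or_lt with rfl | h
  · exact htan.ge
  · exact (two_mul_lt_tan_of_lt hb₀ htan ⟨h, hx.2⟩).le

/-- The conformal parameter of the flat-spherical metric with parameters `ω`
and `b = tan ω - ω`. -/
def modulus (ω : ℝ) : ℝ :=
  2 * Real.arsinh (Real.tan ω) + 2 * ((Real.tan ω - 2 * ω) * (1 / Real.cos ω))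

/-- Past b₀ the difference tan ω - 2ω = ω(tan ω / ω - 2) is a product of nonnegative nondecreasing
factors, and so is its product with 1 / cos ω; the first summand of `modulus` is strictly
increasing. -/
theorem modulus_strictMonoOn (hb₀ : b₀ ∈ Ioo 0 (Real.pi / 2)) (htan : Real.tan b₀ = 2 * b₀) :
    StrictMonoOn modulus (Ico b₀ (Real.pi / 2)) := by
  intro x hx y hy hxy
  have hx0 : 0 < x := hb₀.1.trans_le hx.1
  have hy0 : 0 < y := hx0.trans hxy
  have h1 : Real.tan x < Real.tan y :=
    Real.tan_lt_tan_of_nonneg_of_lt_pi_div_two hx0.le hy.2 hxy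
  have h2 := Real.arsinh_lt_arsinh.2 h1
  have hcy : 0 < Real.cos y := Real.cos_pos_of_mem_Ioo ⟨by linarith [Real.pi_pos], hy.2⟩
  have h3 : Real.cos y < Real.cos x :=
    Real.cos_lt_cos_of_nonneg_of_le_pi_div_two hx0.le hy.2.le hxy
  have h4 : 1 / Real.cos x ≤ 1 / Real.cos y := one_div_le_one_div_of_le hcy h3.le
  have h5 : Real.tan x - 2 * x ≤ Real.tan y - 2 * y := by
    have h := tan_div_self_strictMonoOn ⟨hx0, hx.2⟩ ⟨hy0, hy.2⟩ hxy
    have hx2 : 0 ≤ Real.tan x / x - 2 := by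
      rw [sub_nonneg, le_div_iff₀ hx0]
      exact two_mul_le_tan_of_le hb₀ htan hx
    have e1 : Real.tan x - 2 * x = x * (Real.tan x / x - 2) := by field_simp
    have e2 : Real.tan y - 2 * y = y * (Real.tan y / y - 2) := by field_simp
    rw [e1, e2]
    exact mul_le_mul hxy.le (by simp only at h; linarith) hx2 hy0.le
  have h6 : 0 ≤ Real.tan x - 2 * x := sub_nonneg.2 (two_mul_le_tan_of_le hb₀ htan hx)
  have h7 := mul_le_mul h5 h4 (one_div_nonneg.2 (hcy.trans h3).le) (h6.trans h5)
  rw [modulus, modulus]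
  linarith

theorem arctan_sinh_mem {t : ℝ} (ht : 0 < t) :
    Real.arctan (Real.sinh t) ∈ Ioo 0 (Real.pi / 2) :=
  ⟨Real.arctan_pos.2 (Real.sinh_pos_iff.2 ht), Real.arctan_lt_pi_div_two _⟩

theorem exists_modulus_eq (hb₀ : b₀ ∈ Ioo 0 (Real.pi / 2)) (htan : Real.tan b₀ = 2 * b₀) {β : ℝ}
    (hβ : 2 * Real.arsinh (Real.tan b₀) < β) :
    ∃ ω ∈ Ioo b₀ (Real.pi / 2), modulus ω = β := by
  have hβ0 : 0 < Real.arsinh (Real.tan b₀) :=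
    Real.arsinh_pos_iff.2 (Real.tan_pos_of_pos_of_lt_pi_div_two hb₀.1 hb₀.2)
  have hω₁ := arctan_sinh_mem (t := β / 2) (by linarith)
  set ω₁ := Real.arctan (Real.sinh (β / 2)) with hdef
  have htω : Real.tan ω₁ = Real.sinh (β / 2) := Real.tan_arctan _
  have hlt : b₀ < ω₁ := by
    rw [hdef, ← Real.arctan_tan (by linarith [hb₀.1, Real.pi_pos]) hb₀.2]
    refine Real.arctan_strictMono ?_
    rw [← Real.sinh_arsinh (Real.tan b₀)]
    exact Real.sinh_lt_sinh.2 (by linarith)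
  have h0 : modulus b₀ < β := by
    rw [modulus, htan, sub_self]
    rw [htan] at hβ
    linarith
  -- At ω₁ the first summand of `modulus` alone equals β, and the second is nonnegative since ω₁ >
  -- b₀.
  have h1 : β ≤ modulus ω₁ := by
    have hc : 0 < Real.cos ω₁ :=
      Real.cos_pos_of_mem_Ioo ⟨by linarith [hω₁.1, Real.pi_pos], hω₁.2⟩
    have h2 : 0 ≤ Real.tan ω₁ - 2 * ω₁ :=
      sub_nonneg.2 (two_mul_le_tan_of_le hb₀ htan ⟨hlt.le, hω₁.2⟩)
    have h3 : 0 ≤ (Real.tan ω₁ - 2 * ω₁) * (1 / Real.cos ω₁) := by positivity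
    rw [modulus]
    rw [htω] at h3 ⊢
    rw [Real.arsinh_sinh]
    linarith
  have hcont : ContinuousOn modulus (Icc b₀ ω₁) := by
    intro x hx
    have hc : Real.cos x ≠ 0 :=
      (Real.cos_pos_of_mem_Ioo ⟨by linarith [hx.1, hb₀.1, Real.pi_pos], hx.2.trans_lt hω₁.2⟩).ne'
    have ht : ContinuousAt Real.tan x := Real.continuousAt_tan.2 hc
    have ha : ContinuousAt (fun x => Real.arsinh (Real.tan x)) x := ht.arsinh
    have hcc : ContinuousAt (fun x => 1 / Real.cos x) x :=
      continuousAt_const.div Real.continuous_cos.continuousAt hc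
    exact ((ha.const_mul 2).add (((ht.sub (continuousAt_id.const_mul 2)).mul hcc).const_mul
      2)).continuousWithinAt
  obtain ⟨ω, hω, heq⟩ := intermediate_value_Icc hlt.le hcont ⟨h0.le, h1⟩
  refine ⟨ω, ⟨lt_of_le_of_ne hω.1 ?_, hω.2.trans_lt hω₁.2⟩, heq⟩
  rintro rfl
  exact h0.ne heq

theorem modulus_eq_iff {ω β : ℝ} (hω : ω ∈ Ioo 0 (Real.pi / 2)) :
    2 * Real.sin ω = (β - 2 * Real.log (Real.tan (Real.pi / 4 + ω / 2))) * Real.cos ω ^ 2 +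
      4 * ω * Real.cos ω ↔ modulus ω = β := by
  have hc : 0 < Real.cos ω := Real.cos_pos_of_mem_Ioo ⟨by linarith [hω.1, Real.pi_pos], hω.2⟩
  rw [log_tan_eq_arsinh_tan hω, modulus]
  have hs : Real.sin ω = Real.tan ω * Real.cos ω := (Real.tan_mul_cos hc.ne').symm
  rw [hs]
  constructor
  · intro h
    field_simp
    have h2 : Real.cos ω * (2 * Real.tan ω) =
        Real.cos ω * ((β - 2 * Real.arsinh (Real.tan ω)) * Real.cos ω + 4 * ω) := by
      linear_combination h
    have := mul_left_cancel₀ hc.ne' h2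
    linear_combination this
  · rintro rfl
    field_simp
    ring

end thresholds

/-! ### The inequality and the equality case, in terms of `ω` -/

section omega
variable {ω β : ℝ}

theorem one_div_cosh_arsinh_tan (hω : ω ∈ Ioo 0 (Real.pi / 2)) :
    1 / Real.cosh (Real.arsinh (Real.tan ω)) = Real.cos ω := by
  rw [Real.cosh_arsinh, one_div, Real.inv_sqrt_one_add_tan_sq
    (Real.cos_pos_of_mem_Ioo ⟨by linarith [hω.1, Real.pi_pos], hω.2⟩)]

theorem arctan_sinh_arsinh_tan (hω : ω ∈ Ioo 0 (Real.pi / 2)) :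
    Real.arctan (Real.sinh (Real.arsinh (Real.tan ω))) = ω := by
  rw [Real.sinh_arsinh, Real.arctan_tan (by linarith [hω.1, Real.pi_pos]) hω.2]

theorem tan_div_sqrt (hω : ω ∈ Ioo 0 (Real.pi / 2)) :
    Real.tan ω / Real.sqrt (1 + Real.tan ω ^ 2) = Real.sin ω := by
  have hc : 0 < Real.cos ω := Real.cos_pos_of_mem_Ioo ⟨by linarith [hω.1, Real.pi_pos], hω.2⟩
  rw [div_eq_mul_inv, Real.inv_sqrt_one_add_tan_sq hc, Real.tan_mul_cos hc.ne']

theorem arsinh_tan_pos (hω : ω ∈ Ioo 0 (Real.pi / 2)) : 0 < Real.arsinh (Real.tan ω) :=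
  Real.arsinh_pos_iff.2 (Real.tan_pos_of_pos_of_lt_pi_div_two hω.1 hω.2)

theorem extremal_vol_eq (hβ : 0 < β) (hω : ω ∈ Ioo 0 (Real.pi / 2))
    (hL : Real.arsinh (Real.tan ω) ≤ β / 2) :
    (extremal β (Real.arsinh (Real.tan ω))).vol = 4 * Real.pi *
      (Real.sin ω + (β / 2 - Real.arsinh (Real.tan ω)) * Real.cos ω ^ 2) := by
  rw [extremal_vol hβ, integral_profile_sq hβ (arsinh_tan_pos hω).le hL,
    one_div_cosh_arsinh_tan hω, Real.tanh_arsinh, tan_div_sqrt hω]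
  ring

theorem arcLen_half_eq (hβ : 0 < β) (hω : ω ∈ Ioo 0 (Real.pi / 2))
    (hL : Real.arsinh (Real.tan ω) ≤ β / 2) :
    arcLen β (Real.arsinh (Real.tan ω)) (β / 2) =
      ω + (β / 2 - Real.arsinh (Real.tan ω)) * Real.cos ω := by
  rw [arcLen_half hβ (arsinh_tan_pos hω).le hL, one_div_cosh_arsinh_tan hω,
    arctan_sinh_arsinh_tan hω]

theorem sin_sub_mul_pos (hω : ω ∈ Ioo 0 (Real.pi / 2)) {m : ℝ} (hm : m ≤ Real.cos ω) :
    0 < Real.sin ω - m * ω := by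
  have hc : 0 < Real.cos ω := Real.cos_pos_of_mem_Ioo ⟨by linarith [hω.1, Real.pi_pos], hω.2⟩
  have h1 := Real.lt_tan hω.1 hω.2
  have h2 := Real.tan_mul_cos hc.ne'
  nlinarith [mul_le_mul_of_nonneg_right hm hω.1.le, mul_lt_mul_of_pos_right h1 hc]

/-- The calibration with τ = tan ω and weight `profile`, divided by the common factor 4π. The level
m stays free because the two regimes choose it differently. -/
theorem RiemMetric.Conformal.lv_mul_lσ_le_of_angle {g : RiemMetric β} (hg : g.Conformal (flat β))
    (hβ : 0 < β) (hω : ω ∈ Ioo 0 (Real.pi / 2)) (hL : Real.arsinh (Real.tan ω) ≤ β / 2) {m : ℝ}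
    (hm0 : 0 ≤ m) (hm : m ≤ Real.cos ω) :
    4 * m * (Real.sin ω - m * ω) * (g.lv * g.lσ) ≤
      (Real.sin ω + (β / 2 - Real.arsinh (Real.tan ω)) * Real.cos ω ^ 2) * g.vol := by
  have hsin : 0 < Real.sin ω := Real.sin_pos_of_pos_of_lt_pi hω.1 (by linarith [hω.1, hω.2])
  have hcs : 1 / √(1 + Real.tan ω ^ 2) = Real.cos ω := by
    rw [← Real.cosh_arsinh, one_div_cosh_arsinh_tan hω]
  have hV := extremal_vol_eq hβ hω hL
  have hV0 : 0 < 4 * Real.pi *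
      (Real.sin ω + (β / 2 - Real.arsinh (Real.tan ω)) * Real.cos ω ^ 2) := by
    have := mul_nonneg (sub_nonneg.2 hL) (sq_nonneg (Real.cos ω))
    exact mul_pos (by positivity) (by linarith)
  have h := hg.lv_mul_lσ_le hβ (Real.tan_pos_of_pos_of_lt_pi_div_two hω.1 hω.2) hm0
    (hm.trans_eq hcs.symm) hL continuous_profile profile_periodic
    (fun y => (hm.trans_eq (one_div_cosh_arsinh_tan hω).symm).trans
      (one_div_cosh_le_profile (arsinh_tan_pos hω).le y))
    (fun y hy => profile_of_abs_le hβ hL hy) (hV.symm.trans (extremal_vol hβ)) hV0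
    (by
      rw [tan_div_sqrt hω, Real.arctan_tan (by linarith [hω.1, Real.pi_pos]) hω.2]
      exact (sin_sub_mul_pos hω hm).le)
  rw [tan_div_sqrt hω, Real.arctan_tan (by linarith [hω.1, Real.pi_pos]) hω.2] at h
  refine le_of_mul_le_mul_left (a := 4 * Real.pi) ?_ (by positivity)
  linarith

theorem le_extremal_lv_mul_lσ (hβ : 0 < β) (hω : ω ∈ Ioo 0 (Real.pi / 2))
    (hL : Real.arsinh (Real.tan ω) ≤ β / 2) :
    4 * (ω + (β / 2 - Real.arsinh (Real.tan ω)) * Real.cos ω) * Real.pi ≤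
      (extremal β (Real.arsinh (Real.tan ω))).lv * (extremal β (Real.arsinh (Real.tan ω))).lσ := by
  rw [← arcLen_half_eq hβ hω hL]
  exact mul_le_mul (le_extremal_lv hβ) (pi_le_extremal_lσ hβ (arsinh_tan_pos hω).le)
    Real.pi_pos.le (RiemMetric.lv_nonneg _)

theorem extremal_isFlatSpherical_of_angle (hβ : 0 < β) (hω : ω ∈ Ioo 0 (Real.pi / 2))
    (hL : Real.arsinh (Real.tan ω) ≤ β / 2) :
    (extremal β (Real.arsinh (Real.tan ω))).IsFlatSpherical
      (ω + (β / 2 - Real.arsinh (Real.tan ω)) * Real.cos ω) ω := by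
  have h := extremal_isFlatSpherical hβ (arsinh_tan_pos hω).le hL
  rwa [arcLen_half_eq hβ hω hL, arctan_sinh_arsinh_tan hω] at h

end omega

/-- The left side is tanh(β / 2), the sine of the latitude of Mercator height β / 2. -/
theorem exp_sub_one_div_exp_add_one {b : ℝ} (hb : b ∈ Ioo 0 (Real.pi / 2)) {β : ℝ}
    (h : Real.arsinh (Real.tan b) = β / 2) :
    (Real.exp β - 1) / (Real.exp β + 1) = Real.sin b := by
  rw [← tan_div_sqrt hb, ← Real.tanh_arsinh, h, Real.tanh_eq_sinh_div_cosh, Real.sinh_eq,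
    Real.cosh_eq, Real.exp_neg]
  have h2 : Real.exp β = Real.exp (β / 2) ^ 2 := by rw [← Real.exp_nat_mul]; congr 1; push_cast; ring
  rw [h2]
  field_simp

end Klein

end

/-! ### The two regimes -/

theorem theorem1 (b₀ : ℝ) (hb₀ : b₀ ∈ Set.Ioo 0 (Real.pi / 2)) (htan : Real.tan b₀ = 2 * b₀)
    (β : ℝ) (hβ : 0 < β) :
    (β ≤ 2 * Real.log (Real.tan (Real.pi / 4 + b₀ / 2)) →
      (∀ g : Klein.RiemMetric β, g.Conformal (Klein.flat β) →
        g.lv * g.lσ ≤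
          Real.arcsin ((Real.exp β - 1) / (Real.exp β + 1)) /
            ((Real.exp β - 1) / (Real.exp β + 1)) * g.vol) ∧
      ∃ b ∈ Set.Ioc 0 b₀, β = 2 * Real.log (Real.tan (Real.pi / 4 + b / 2)) ∧
        ∃ g : Klein.RiemMetric β, g.Conformal (Klein.flat β) ∧ g.IsSpherical b ∧
          g.lv * g.lσ =
            Real.arcsin ((Real.exp β - 1) / (Real.exp β + 1)) /
              ((Real.exp β - 1) / (Real.exp β + 1)) * g.vol) ∧
    (2 * Real.log (Real.tan (Real.pi / 4 + b₀ / 2)) < β →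
      ∃ ω ∈ Set.Ico b₀ (Real.pi / 2),
        (∀ ω' ∈ Set.Ico b₀ (Real.pi / 2),
          2 * Real.sin ω' =
            (β - 2 * Real.log (Real.tan (Real.pi / 4 + ω' / 2))) * Real.cos ω' ^ 2 +
              4 * ω' * Real.cos ω' ↔ ω' = ω) ∧
        (∀ g : Klein.RiemMetric β, g.Conformal (Klein.flat β) →
          g.lv * g.lσ ≤ 1 / (2 * Real.cos ω) * g.vol) ∧
        ∃ b, ω < b ∧ Real.tan ω = b + ω ∧
          ∃ g : Klein.RiemMetric β, g.Conformal (Klein.flat β) ∧ g.IsFlatSpherical b ω ∧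
            g.lv * g.lσ = 1 / (2 * Real.cos ω) * g.vol) := by
  rw [Klein.log_tan_eq_arsinh_tan hb₀]
  constructor
  · intro hle
    have hb := Klein.arctan_sinh_mem (t := β / 2) (by linarith)
    set b := Real.arctan (Real.sinh (β / 2)) with hdef
    have hL : Real.arsinh (Real.tan b) = β / 2 := by
      rw [hdef, Real.tan_arctan, Real.arsinh_sinh]
    have hbb₀ : b ≤ b₀ := by
      rw [hdef, ← Real.arctan_tan (by linarith [hb₀.1, Real.pi_pos]) hb₀.2]
      refine Real.arctan_strictMono.monotone ?_
      rw [← Real.sinh_arsinh (Real.tan b₀)]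
      exact Real.sinh_le_sinh.2 (by linarith)
    have hsin : 0 < Real.sin b := Real.sin_pos_of_pos_of_lt_pi hb.1 (by linarith [hb.1, hb.2])
    have hcos : 0 < Real.cos b :=
      Real.cos_pos_of_mem_Ioo ⟨by linarith [hb.1, Real.pi_pos], hb.2⟩
    -- This level m makes the two terms of the calibration equal for the spherical metric, where l_v
    -- = 4b and l_σ = π. Its admissibility is the condition tan b ≤ 2b.
    have hm : Real.sin b / (2 * b) ≤ Real.cos b := by
      have h1 := Klein.tan_le_two_mul_of_le hb₀ htan ⟨hb.1, hbb₀⟩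
      rw [div_le_iff₀ (by linarith [hb.1]), ← Real.tan_mul_cos hcos.ne', mul_comm]
      exact mul_le_mul_of_nonneg_left h1 hcos.le
    have hb0 := hb.1
    rw [Klein.exp_sub_one_div_exp_add_one hb hL,
      Real.arcsin_sin (by linarith [Real.pi_pos]) hb.2.le]
    have hupper : ∀ g : Klein.RiemMetric β, g.Conformal (Klein.flat β) →
        g.lv * g.lσ ≤ b / Real.sin b * g.vol := by
      intro g hg
      have h := hg.lv_mul_lσ_le_of_angle hβ hb hL.le (by positivity) hm
      have e : 4 * (Real.sin b / (2 * b)) * (Real.sin b - Real.sin b / (2 * b) * b) =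
          Real.sin b * (Real.sin b / b) := by
        field_simp
        ring
      rw [hL, sub_self, zero_mul, add_zero, e, mul_assoc] at h
      have h2 := le_of_mul_le_mul_left h hsin
      rw [div_mul_eq_mul_div, div_le_iff₀ hb0] at h2
      rw [div_mul_eq_mul_div, le_div_iff₀ hsin]
      linarith
    refine ⟨hupper, b, ⟨hb.1, hbb₀⟩, ?_, Klein.extremal β (Real.arsinh (Real.tan b)),
      Klein.extremal_conformal, ?_, le_antisymm (hupper _ Klein.extremal_conformal) ?_⟩
    · rw [Klein.log_tan_eq_arsinh_tan hb, hL]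
      ring
    · have h := Klein.extremal_isFlatSpherical_of_angle hβ hb hL.le
      rw [show b + (β / 2 - Real.arsinh (Real.tan b)) * Real.cos b = b by rw [hL]; ring] at h
      exact h.isSpherical
    -- The product of the lower bounds 4b and π is already b / sin b times the area 4π sin b.
    · refine le_trans (le_of_eq ?_) (Klein.le_extremal_lv_mul_lσ hβ hb hL.le)
      rw [Klein.extremal_vol_eq hβ hb hL.le, hL]
      field_simp
      ring
  · intro hlt
    obtain ⟨ω, hω, heq⟩ := Klein.exists_modulus_eq hb₀ htan hlt
    have hω' : ω ∈ Set.Ioo 0 (Real.pi / 2) := ⟨hb₀.1.trans hω.1, hω.2⟩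
    have hωI : ω ∈ Set.Ico b₀ (Real.pi / 2) := ⟨hω.1.le, hω.2⟩
    have hcos : 0 < Real.cos ω :=
      Real.cos_pos_of_mem_Ioo ⟨by linarith [hω'.1, Real.pi_pos], hω.2⟩
    have hgap := Klein.two_mul_lt_tan_of_lt hb₀ htan hω
    have hdiff : β / 2 - Real.arsinh (Real.tan ω) =
        (Real.tan ω - 2 * ω) * (1 / Real.cos ω) := by
      rw [← heq, Klein.modulus]
      ring
    have hL : Real.arsinh (Real.tan ω) ≤ β / 2 := by
      have : 0 ≤ (Real.tan ω - 2 * ω) * (1 / Real.cos ω) :=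
        mul_nonneg (by linarith) (by positivity)
      linarith
    have htc := Real.tan_mul_cos hcos.ne'
    have hb : ω + (β / 2 - Real.arsinh (Real.tan ω)) * Real.cos ω = Real.tan ω - ω := by
      rw [hdiff]
      field_simp
      ring
    have hV : Real.sin ω + (β / 2 - Real.arsinh (Real.tan ω)) * Real.cos ω ^ 2 =
        2 * (Real.sin ω - Real.cos ω * ω) := by
      rw [hdiff, ← htc]
      field_simp
      ring
    have hpos := Klein.sin_sub_mul_pos hω' le_rfl
    have hupper : ∀ g : Klein.RiemMetric β, g.Conformal (Klein.flat β) →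
        g.lv * g.lσ ≤ 1 / (2 * Real.cos ω) * g.vol := by
      intro g hg
      -- The balancing level now exceeds the minimum of the profile, so m takes the largest
      -- admissible value cos ω. The equation for ω restores the balance by adjusting the plateau.
      have h := hg.lv_mul_lσ_le_of_angle hβ hω' hL hcos.le le_rfl
      rw [hV] at h
      have h2 : (Real.sin ω - Real.cos ω * ω) * (2 * Real.cos ω * (g.lv * g.lσ)) ≤
          (Real.sin ω - Real.cos ω * ω) * g.vol := by linarith
      have h3 := le_of_mul_le_mul_left h2 hpos
      rw [div_mul_eq_mul_div, le_div_iff₀ (by positivity)]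
      linarith
    refine ⟨ω, hωI, fun ω' h' => ?_, hupper, Real.tan ω - ω, by linarith, by ring,
      Klein.extremal β (Real.arsinh (Real.tan ω)), Klein.extremal_conformal, ?_,
      le_antisymm (hupper _ Klein.extremal_conformal) ?_⟩
    · rw [Klein.modulus_eq_iff ⟨hb₀.1.trans_le h'.1, h'.2⟩, ← heq]
      exact (Klein.modulus_strictMonoOn hb₀ htan).injOn.eq_iff h' hωI
    · have h := Klein.extremal_isFlatSpherical_of_angle hβ hω' hL
      rwa [hb] at h
    · refine le_trans (le_of_eq ?_) (Klein.le_extremal_lv_mul_lσ hβ hω' hL)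
      rw [Klein.extremal_vol_eq hβ hω' hL, hV, hb, ← htc]
      field_simp
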